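/- Let $n\ge 1$. All crystals below consist of a nonempty set $\mathcal B$ with a weight map $\mathrm{wt}:\mathcal B\to\mathbb Z^n$ and raising and lowering operators $e_i,f_i:\mathcal B\to\mathcal B\sqcup\{0\}$, where $0\notin\mathcal B$ is an auxiliary element with $e_i(0)=f_i(0)=0$ and $i$ runs over $\{0,1,\dots,n-1\}$, and also over $\bar 1$ if $n\ge 2$. Put $\varepsilon_i(b)=\max\{k\ge 0: e_i^k(b)\ne 0\}$ and $\varphi_i(b)=\max\{k\ge 0: f_i^k(b)\neq 0\}$ in $\mathbb N\sqcup\{\infty\}$, and write $\mathbf e_1,\dots,\mathbf e_n$ for the standard basis of $\mathbb Z^n$. Such a $\mathcal B$ is a *$\mathfrak q^+_n$-crystal* if $\mathrm{wt}(\mathcal B)\subset\mathbb N^n$ and for all $b,c\in\mathcal B$: - for all $i$: $e_i(b)=c$ if and only if $f_i(c)=b$, and in this case $\mathrm{wt}(c)-\mathrm{wt}(b)$ is $\mathbf e_i-\mathbf e_{i+1}$ if $1\le i\le n-1$, $\mathbf e_1-\mathbf e_2$ if $i=\bar 1$, and $0$ if $i=0$; - for $1\le i\le n-1$: $\varepsilon_i(b)$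 and $\varphi_i(b)$ are finite and $\varphi_i(b)-\varepsilon_i(b)=\mathrm{wt}(b)_i-\mathrm{wt}(b)_{i+1}$; - if $n\ge2$: if $e_{\bar 1}(b)=c$, then $\varepsilon_i(b)=\varepsilon_i(c)$ and $\varphi_i(b)=\varphi_i(c)$ for $3\le i\le n-1$; $e_i,f_i$ commute with $e_{\bar 1},f_{\bar 1}$ for $3\le i\le n-1$; and $\varepsilon_{\bar 1}(b)+\varphi_{\bar 1}(b)$ is $0$ if $\mathrm{wt}(b)_1=\mathrm{wt}(b)_2=0$ and $1$ otherwise; - if $e_0(b)=c$, then $\varepsilon_i(b)=\varepsilon_i(c)$ and $\varphi_i(b)=\varphi_i(c)$ for all $i\ne 0$; $e_i,f_i$ commute with $e_0,f_0$ for $2\le i\le n-1$; and $\varepsilon_0(b)+\varphi_0(b)$ is $0$ if $\mathrm{wt}(b)_1=0$ and $1$ otherwise. The *crystal graph* has vertex set $\mathcal B$ and an edge $b\xrightarrow{i}c$ whenever $f_i(b)=c\ne0$. A *full subcrystal* is a weakly connected component of this graph, and an *isomorphism* is a weight-preserving bijection that is an isomorphism of the labeled crystal graphs. The *standard $\mathfrak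 q^+_n$-crystal* $\mathbb B^+_n$ has elements $1,\dots,n,1',\dots,n'$, where $i$ and $i'$ have weight $\mathbf e_i$, and edges $i\xrightarrow{i}i+1$ and $i'\xrightarrow{i}(i+1)'$ for $1\le i\le n-1$, $1\xrightarrow{\bar1}2$ and $1'\xrightarrow{\bar1}2'$ (if $n\geq 2$), and $1\xrightarrow{0}1'$. The *tensor product* of $\mathfrak q^+_n$-crystals $\mathcal B,\mathcal C$ is the set of formal tensors $b\otimes c$ with $\mathrm{wt}(b\otimes c)=\mathrm{wt}(b)+\mathrm{wt}(c)$ and with the following operators, where $b\otimes 0=0\otimes c=0$. For $1\le i\le n-1$, $e_i(b\otimes c)$ is $b\otimes e_i(c)$ if $\varepsilon_i(b)\le\varphi_i(c)$ and $e_i(b)\otimes c$ otherwise, and $f_i(b\otimes c)$ is $b\otimes f_i(c)$ if $\varepsilon_i(b)<\varphi_i(c)$ and $f_i(b)\otimes c$ otherwise. For $g\in\{e_0,f_0\}$, $g(b\otimes c)$ is $g(b)\otimes c$ if $\mathrm{wt}(b)_1\ne0$ and $b\otimes g(c)$ otherwise. If $n\ge2$, then $$e_{\bar1}(b\otimes c)=\begin{cases}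 b\otimes e_{\bar1}(c)&\text{if }\mathrm{wt}(b)_1=\mathrm{wt}(b)_2=0\\ f_0e_{\bar1}(b)\otimes e_0(c)&\text{if }\mathrm{wt}(b)_1=0,\ f_0e_{\bar1}(b)\ne0,\ e_0(c)\ne0\\ e_0e_{\bar1}(b)\otimes f_0(c)&\text{if }\mathrm{wt}(b)_1=0,\ e_0e_{\bar1}(b)\ne0,\ f_0(c)\ne0\\ e_{\bar1}(b)\otimes c&\text{otherwise,}\end{cases}$$ $$f_{\bar1}(b\otimes c)=\begin{cases} b\otimes f_{\bar1}(c)&\text{if }\mathrm{wt}(b)_1=\mathrm{wt}(b)_2=0\\ f_{\bar1}f_0(b)\otimes e_0(c)&\text{if }\mathrm{wt}(b)_1=1,\ f_{\bar1}f_0(b)\ne0,\ e_0(c)\ne0\\ f_{\bar1}e_0(b)\otimes f_0(c)&\text{if }\mathrm{wt}(b)_1=1,\ f_{\bar1}e_0(b)\ne0,\ f_0(c)\ne0\\ f_{\bar1}(b)\otimes c&\text{otherwise.}\end{cases}$$ Let $(\mathbb B^+_n)^{\otimes 0}$ be the crystal with a single element, of weight $0$, on which all operators are $0$. A $\mathfrak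 q^+_n$-crystal is *normal* if each of its full subcrystals is isomorphic to a full subcrystal of $(\mathbb B^+_n)^{\otimes m}$ for some $m\in\mathbb N$. For $0\le i\le n-1$ and $b\in\mathcal B$ put $k=\varphi_i(b)-\varepsilon_i(b)$ and let $\sigma_i(b)=f_i^{k}(b)$ if $k\ge0$ and $\sigma_i(b)=e_i^{-k}(b)$ if $k\le0$; so $\sigma_i:\mathcal B\to\mathcal B$ reverses each $i$-string. Let $W^{\mathsf{BC}}_n$ be the hyperoctahedral group of all permutations $w$ of $\mathbb Z$ with $w(-i)=-w(i)$ for all $i\in\mathbb Z$ and $w(i)=i$ for all $i>n$, and put $t_0=(-1,1)$ and $t_i=(i,i+1)(-i,-i-1)$ for $1\le i\le n-1$. **Theorem.** Let $\mathcal B$ be a normal $\mathfrak q^+_n$-crystal. Then there exists a unique action of $W^{\mathsf{BC}}_n$ on the set $\mathcal B$ in which $t_i$ acts as $\sigma_i$ for each $0\le i\le n-1$. -/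

import Mathlib

noncomputable section

namespace QPlus

/-- Labels of the operators of a `q⁺_n`-crystal: the queer label `1̄` (present only for `n ≥ 2`),
the label `0`, and the labels `1, …, n - 1`; `gl i` stands for the label `i + 1`. -/
inductive Label (n : ℕ) : Type
  | bar (h : 2 ≤ n) : Label n
  | zero : Label n
  | gl (i : ℕ) (hi : i + 1 < n) : Label n

/-- A weight map and raising and lowering operators on a set `B`, without axioms.
The value `none` plays the role of the auxiliary element `0 ∉ B`.
Coordinates of weights are numbered from `0`. -/
structure CrystalData (n : ℕ) (B : Type*) where
  wt : B → Fin n → ℤ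
  e : Label n → B → Option B
  f : Label n → B → Option B

/-- The `k`-th power of a partial operator, which is extended by sending `0` to `0`. -/
def opPow {B : Type*} (g : B → Option B) (k : ℕ) (b : B) : Option B :=
  (fun o : Option B => o.bind g)^[k] (some b)

/-- `max {k : g ^ k (b) ≠ 0}`, which is `∞` when there is no maximum. -/
def stringLength {B : Type*} (g : B → Option B) (b : B) : ℕ∞ :=
  ⨆ (k : ℕ) (_ : opPow g k b ≠ none), (k : ℕ∞)

/-- Two partial operators commute, both being extended by sending `0` to `0`. -/
def OpCommute {B : Type*} (g h : B → Option B) : Prop :=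
  ∀ b, (h b).bind g = (g b).bind h

namespace CrystalData

variable {n : ℕ} {B C : Type*}

/-- The string length `ε_i`. -/
def ε (X : CrystalData n B) (i : Label n) (b : B) : ℕ∞ := stringLength (X.e i) b

/-- The string length `φ_i`. -/
def φ (X : CrystalData n B) (i : Label n) (b : B) : ℕ∞ := stringLength (X.f i) b

/-- The axioms of a `gl_n`-crystal. -/
structure IsGLCrystal (X : CrystalData n B) : Prop where
  nonempty : Nonempty B
  e_eq_iff : ∀ (i : ℕ) (hi : i + 1 < n) (b c : B),
    X.e (.gl i hi) b = some c ↔ X.f (.gl i hi) c = some b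
  wt_e : ∀ (i : ℕ) (hi : i + 1 < n) (b c : B), X.e (.gl i hi) b = some c →
    X.wt c - X.wt b = Pi.single ⟨i, by omega⟩ 1 - Pi.single ⟨i + 1, hi⟩ 1
  ε_finite : ∀ (i : ℕ) (hi : i + 1 < n) (b : B), X.ε (.gl i hi) b ≠ ⊤
  φ_finite : ∀ (i : ℕ) (hi : i + 1 < n) (b : B), X.φ (.gl i hi) b ≠ ⊤
  φ_sub_ε : ∀ (i : ℕ) (hi : i + 1 < n) (b : B),
    ((X.φ (.gl i hi) b).toNat : ℤ) - ((X.ε (.gl i hi) b).toNat : ℤ) =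
      X.wt b ⟨i, by omega⟩ - X.wt b ⟨i + 1, hi⟩

/-- The axioms of a `q_n`-crystal. For `n = 1` those on the operators are vacuous. The labels
`3, …, n - 1` are the `gl i` with `2 ≤ i`. -/
structure IsQCrystal (X : CrystalData n B) : Prop extends IsGLCrystal X where
  wt_nonneg : ∀ b j, 0 ≤ X.wt b j
  bar_e_eq_iff : ∀ (h : 2 ≤ n) (b c : B), X.e (.bar h) b = some c ↔ X.f (.bar h) c = some b
  bar_wt_e : ∀ (h : 2 ≤ n) (b c : B), X.e (.bar h) b = some c →
    X.wt c - X.wt b = Pi.single ⟨0, by omega⟩ 1 - Pi.single ⟨1, h⟩ 1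
  bar_ε_eq : ∀ (h : 2 ≤ n) (b c : B), X.e (.bar h) b = some c →
    ∀ (i : ℕ) (hi : i + 1 < n), 2 ≤ i → X.ε (.gl i hi) b = X.ε (.gl i hi) c
  bar_φ_eq : ∀ (h : 2 ≤ n) (b c : B), X.e (.bar h) b = some c →
    ∀ (i : ℕ) (hi : i + 1 < n), 2 ≤ i → X.φ (.gl i hi) b = X.φ (.gl i hi) c
  bar_commute : ∀ (h : 2 ≤ n) (i : ℕ) (hi : i + 1 < n), 2 ≤ i →
    OpCommute (X.e (.gl i hi)) (X.e (.bar h)) ∧ OpCommute (X.e (.gl i hi)) (X.f (.bar h)) ∧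
    OpCommute (X.f (.gl i hi)) (X.e (.bar h)) ∧ OpCommute (X.f (.gl i hi)) (X.f (.bar h))
  bar_string_zero : ∀ (h : 2 ≤ n) (b : B), X.wt b ⟨0, by omega⟩ = 0 ∧ X.wt b ⟨1, h⟩ = 0 →
    X.ε (.bar h) b + X.φ (.bar h) b = 0
  bar_string_one : ∀ (h : 2 ≤ n) (b : B), ¬ (X.wt b ⟨0, by omega⟩ = 0 ∧ X.wt b ⟨1, h⟩ = 0) →
    X.ε (.bar h) b + X.φ (.bar h) b = 1

/-- The axioms of a `q⁺_n`-crystal. The labels `2, …, n - 1` are the `gl i` with `1 ≤ i`. -/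
structure IsQPlusCrystal [NeZero n] (X : CrystalData n B) : Prop extends IsQCrystal X where
  zero_e_eq_iff : ∀ b c : B, X.e .zero b = some c ↔ X.f .zero c = some b
  zero_wt_e : ∀ b c : B, X.e .zero b = some c → X.wt b = X.wt c
  zero_ε_eq : ∀ b c : B, X.e .zero b = some c → ∀ i : Label n, i ≠ .zero → X.ε i b = X.ε i c
  zero_φ_eq : ∀ b c : B, X.e .zero b = some c → ∀ i : Label n, i ≠ .zero → X.φ i b = X.φ i c
  zero_commute : ∀ (i : ℕ) (hi : i + 1 < n), 1 ≤ i →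
    OpCommute (X.e (.gl i hi)) (X.e .zero) ∧ OpCommute (X.e (.gl i hi)) (X.f .zero) ∧
    OpCommute (X.f (.gl i hi)) (X.e .zero) ∧ OpCommute (X.f (.gl i hi)) (X.f .zero)
  zero_string_zero : ∀ b : B, X.wt b 0 = 0 → X.ε .zero b + X.φ .zero b = 0
  zero_string_one : ∀ b : B, X.wt b 0 ≠ 0 → X.ε .zero b + X.φ .zero b = 1

/-- `x ⊗ y`, with the convention `b ⊗ 0 = 0 ⊗ c = 0`. -/
def tmul (x : Option B) (y : Option C) : Option (B × C) :=
  x.bind fun b => y.map fun c => (b, c)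

open Classical in
/-- The tensor product of `q⁺_n`-crystals (anti-Kashiwara convention). -/
def tensor [NeZero n] (X : CrystalData n B) (Y : CrystalData n C) : CrystalData n (B × C) where
  wt p := X.wt p.1 + Y.wt p.2
  e i p := match i, p with
    | .gl i hi, (b, c) =>
        if X.ε (.gl i hi) b ≤ Y.φ (.gl i hi) c then tmul (some b) (Y.e (.gl i hi) c)
        else tmul (X.e (.gl i hi) b) (some c)
    | .zero, (b, c) =>
        if X.wt b 0 ≠ 0 then tmul (X.e .zero b) (some c) else tmul (some b) (Y.e .zero c)
    | .bar h, (b, c) =>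
        if X.wt b 0 = 0 ∧ X.wt b ⟨1, h⟩ = 0 then tmul (some b) (Y.e (.bar h) c)
        else if X.wt b 0 = 0 ∧ (X.e (.bar h) b).bind (X.f .zero) ≠ none ∧ Y.e .zero c ≠ none then
          tmul ((X.e (.bar h) b).bind (X.f .zero)) (Y.e .zero c)
        else if X.wt b 0 = 0 ∧ (X.e (.bar h) b).bind (X.e .zero) ≠ none ∧ Y.f .zero c ≠ none then
          tmul ((X.e (.bar h) b).bind (X.e .zero)) (Y.f .zero c)
        else tmul (X.e (.bar h) b) (some c)
  f i p := match i, p with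
    | .gl i hi, (b, c) =>
        if X.ε (.gl i hi) b < Y.φ (.gl i hi) c then tmul (some b) (Y.f (.gl i hi) c)
        else tmul (X.f (.gl i hi) b) (some c)
    | .zero, (b, c) =>
        if X.wt b 0 ≠ 0 then tmul (X.f .zero b) (some c) else tmul (some b) (Y.f .zero c)
    | .bar h, (b, c) =>
        if X.wt b 0 = 0 ∧ X.wt b ⟨1, h⟩ = 0 then tmul (some b) (Y.f (.bar h) c)
        else if X.wt b 0 = 1 ∧ (X.f .zero b).bind (X.f (.bar h)) ≠ none ∧ Y.e .zero c ≠ none then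
          tmul ((X.f .zero b).bind (X.f (.bar h))) (Y.e .zero c)
        else if X.wt b 0 = 1 ∧ (X.e .zero b).bind (X.f (.bar h)) ≠ none ∧ Y.f .zero c ≠ none then
          tmul ((X.e .zero b).bind (X.f (.bar h))) (Y.f .zero c)
        else tmul (X.f (.bar h) b) (some c)

/-- The one-element crystal of weight `0`. -/
def unit (n : ℕ) : CrystalData n Unit where
  wt _ := 0
  e _ _ := none
  f _ _ := none

/-- The standard `q⁺_n`-crystal: `(j, false)` is the letter `j + 1` and `(j, true)` is the primed
letter `(j + 1)'`. -/
def standard (n : ℕ) : CrystalData n (Fin n × Bool) where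
  wt x := Pi.single x.1 1
  e i x := match i with
    | .gl i hi => if x.1 = ⟨i + 1, hi⟩ then some (⟨i, by omega⟩, x.2) else none
    | .bar h => if x.1 = ⟨1, h⟩ then some (⟨0, by omega⟩, x.2) else none
    | .zero => if x.1.val = 0 ∧ x.2 = true then some (x.1, false) else none
  f i x := match i with
    | .gl i hi => if x.1 = ⟨i, by omega⟩ then some (⟨i + 1, hi⟩, x.2) else none
    | .bar h => if x.1 = ⟨0, by omega⟩ then some (⟨1, h⟩, x.2) else none
    | .zero => if x.1.val = 0 ∧ x.2 = false then some (x.1, true) else none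

/-- The underlying set of the `m`-th tensor power of the standard crystal. -/
def PowerCarrier (n : ℕ) : ℕ → Type
  | 0 => Unit
  | m + 1 => (Fin n × Bool) × PowerCarrier n m

/-- The `m`-th tensor power of the standard `q⁺_n`-crystal. -/
def standardPower (n : ℕ) [NeZero n] : (m : ℕ) → CrystalData n (PowerCarrier n m)
  | 0 => unit n
  | m + 1 => tensor (standard n) (standardPower n m)

/-- The crystal graph has an edge (of some label) from `b` to `c`. -/
def Edge (X : CrystalData n B) (b c : B) : Prop := ∃ i, X.f i b = some c

/-- Full subcrystals: the weakly connected components of the crystal graph. -/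
def IsFullSubcrystal (X : CrystalData n B) (S : Set B) : Prop :=
  ∃ b, S = {c | Relation.EqvGen X.Edge b c}

/-- A full subcrystal `S` of `X` and a full subcrystal `T` of `Y` are isomorphic: there is a
weight-preserving bijection that is an isomorphism of edge-labeled crystal graphs. -/
def SubcrystalIso (X : CrystalData n B) (S : Set B) (Y : CrystalData n C) (T : Set C) : Prop :=
  ∃ ψ : S ≃ T, (∀ x : S, Y.wt (ψ x) = X.wt x) ∧
    ∀ (i : Label n) (x y : S), X.f i x = some (y : B) ↔ Y.f i (ψ x) = some (ψ y : C)

/-- Normality: each full subcrystal is isomorphic to a full subcrystal of a tensor power of the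
standard crystal. -/
def IsNormal [NeZero n] (X : CrystalData n B) : Prop :=
  ∀ S : Set B, X.IsFullSubcrystal S →
    ∃ (m : ℕ) (T : Set (PowerCarrier n m)),
      (standardPower n m).IsFullSubcrystal T ∧ SubcrystalIso X S (standardPower n m) T

/-- The operator `σ_i`: with `k = φ_i(b) - ε_i(b)` it sends `b` to `f_i ^ k (b)` if `k ≥ 0` and to
`e_i ^ (-k) (b)` if `k ≤ 0`. String lengths are finite in a `q⁺_n`-crystal. -/
def σ (X : CrystalData n B) (i : Label n) (b : B) : Option B :=
  if (X.ε i b).toNat ≤ (X.φ i b).toNat then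
    opPow (X.f i) ((X.φ i b).toNat - (X.ε i b).toNat) b
  else opPow (X.e i) ((X.ε i b).toNat - (X.φ i b).toNat) b

end CrystalData

/-- The hyperoctahedral group of rank `n`: permutations `w` of `ℤ` with `w (-i) = - w i` for all `i`
and `w i = i` for all `i > n`. -/
def WBC (n : ℕ) : Subgroup (Equiv.Perm ℤ) where
  carrier := {w | (∀ i, w (-i) = - w i) ∧ ∀ i : ℤ, (n : ℤ) < i → w i = i}
  one_mem' := by simp
  mul_mem' := by
    rintro v w ⟨hv, hv'⟩ ⟨hw, hw'⟩
    refine ⟨fun i => ?_, fun i hi => ?_⟩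
    · rw [Equiv.Perm.mul_apply, Equiv.Perm.mul_apply, hw, hv]
    · rw [Equiv.Perm.mul_apply, hw' i hi, hv' i hi]
  inv_mem' := by
    rintro w ⟨hw, hw'⟩
    refine ⟨fun i => ?_, fun i hi => ?_⟩
    · rw [Equiv.Perm.inv_eq_iff_eq, hw]; simp
    · rw [Equiv.Perm.inv_eq_iff_eq, hw' i hi]

/-- The generator `(-1, 1)`. -/
def tZero (n : ℕ) [NeZero n] : WBC n :=
  ⟨Equiv.swap (-1) 1, by
    have hn : 0 < n := Nat.pos_of_ne_zero (NeZero.ne n)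
    refine ⟨fun i => ?_, fun i hi => ?_⟩ <;> simp only [Equiv.swap_apply_def] <;>
      split_ifs <;> omega⟩

/-- The generator `(j, j + 1)(-j, -j - 1)` for `j = i + 1`. -/
def tGL (n : ℕ) (i : ℕ) (hi : i + 1 < n) : WBC n :=
  ⟨Equiv.swap ((i : ℤ) + 1) ((i : ℤ) + 2) * Equiv.swap (-((i : ℤ) + 1)) (-((i : ℤ) + 2)), by
    refine ⟨fun j => ?_, fun j hj => ?_⟩ <;>
      simp only [Equiv.Perm.mul_apply, Equiv.swap_apply_def] <;> split_ifs <;> omega⟩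

end QPlus

end

namespace QPlus

section Strings

variable {B C : Type*}

theorem opPow_zero (g : B → Option B) (b : B) : opPow g 0 b = some b := rfl

theorem opPow_succ' (g : B → Option B) (k : ℕ) (b : B) :
    opPow g (k + 1) b = (opPow g k b).bind g := by
  simp only [opPow, Function.iterate_succ_apply']

theorem iterate_bind_none (g : B → Option B) (k : ℕ) :
    (fun o : Option B => o.bind g)^[k] none = none :=
  Function.iterate_fixed rfl k

theorem opPow_succ (g : B → Option B) (k : ℕ) (b : B) :
    opPow g (k + 1) b = (g b).bind (opPow g k) := by
  simp only [opPow, Function.iterate_succ_apply, Option.bind_some]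
  cases g b with
  | none => rw [iterate_bind_none]; rfl
  | some c => rfl

/-- A rank function that drops by one along `g` and vanishes where `g` does computes the string
lengths of `g`. -/
theorem opPow_ne_none_iff_of_rank {g : B → Option B} {p : B → ℕ}
    (h0 : ∀ b, g b = none → p b = 0) (h1 : ∀ b c, g b = some c → p b = p c + 1)
    (k : ℕ) (b : B) : opPow g k b ≠ none ↔ k ≤ p b := by
  induction k generalizing b with
  | zero => simp [opPow_zero]
  | succ k ih =>
    rw [opPow_succ]
    cases hb : g b with
    | none => simp [h0 b hb]
    | some c => simp [ih c, h1 b c hb]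

theorem stringLength_eq_of_forall {g : B → Option B} {b : B} {N : ℕ}
    (h : ∀ k, opPow g k b ≠ none ↔ k ≤ N) : stringLength g b = N := by
  apply le_antisymm
  · refine iSup₂_le fun k hk => ?_
    exact_mod_cast (h k).1 hk
  · exact le_iSup₂_of_le N ((h N).2 le_rfl) le_rfl

theorem stringLength_eq_of_rank {g : B → Option B} {p : B → ℕ}
    (h0 : ∀ b, g b = none → p b = 0) (h1 : ∀ b c, g b = some c → p b = p c + 1) (b : B) :
    stringLength g b = p b :=
  stringLength_eq_of_forall fun k => opPow_ne_none_iff_of_rank h0 h1 k b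

theorem stringLength_of_none {g : B → Option B} {b : B} (h : g b = none) :
    stringLength g b = 0 := by
  have : stringLength g b = (0 : ℕ) := stringLength_eq_of_forall fun k => by
    cases k with
    | zero => simp [opPow_zero]
    | succ k => simp [opPow_succ, h]
  simpa using this

theorem stringLength_of_some {g : B → Option B} {b c : B} (h : g b = some c) :
    stringLength g b = stringLength g c + 1 := by
  apply le_antisymm
  · refine iSup₂_le fun k hk => ?_
    cases k with
    | zero => simp
    | succ k =>
      rw [opPow_succ, h] at hk
      push_cast
      gcongr
      exact le_iSup₂_of_le k hk le_rfl
  · have hne : ∃ k : ℕ, opPow g k c ≠ none := ⟨0, by simp [opPow_zero]⟩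
    unfold stringLength
    rw [ENat.biSup_add' hne]
    refine iSup₂_le fun k hk => ?_
    refine le_iSup₂_of_le (k + 1) ?_ (by push_cast; rfl)
    rw [opPow_succ, h]; exact hk

/-- Mutually inverse partial operators all of whose strings are finite. -/
structure IsStringPair (e f : B → Option B) : Prop where
  inv : ∀ b c, e b = some c ↔ f c = some b
  e_fin : ∀ b, stringLength e b ≠ ⊤
  f_fin : ∀ b, stringLength f b ≠ ⊤

theorem IsStringPair.swap {e f : B → Option B} (h : IsStringPair e f) : IsStringPair f e :=
  ⟨fun b c => (h.inv c b).symm, h.f_fin, h.e_fin⟩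

theorem IsStringPair.toNat_of_none {e f : B → Option B} (_ : IsStringPair e f) {b : B}
    (hb : f b = none) : (stringLength f b).toNat = 0 := by
  simp [stringLength_of_none hb]

theorem IsStringPair.toNat_of_some {e f : B → Option B} (h : IsStringPair e f) {b c : B}
    (hb : f b = some c) : (stringLength f b).toNat = (stringLength f c).toNat + 1 := by
  rw [stringLength_of_some hb, ENat.toNat_add (h.f_fin c) (by simp)]; simp

theorem IsStringPair.opPow_ne_none_iff {e f : B → Option B} (h : IsStringPair e f) (k : ℕ)
    (b : B) : opPow f k b ≠ none ↔ k ≤ (stringLength f b).toNat :=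
  opPow_ne_none_iff_of_rank (p := fun b => (stringLength f b).toNat)
    (fun _ hb => h.toNat_of_none hb) (fun _ _ hb => h.toNat_of_some hb) k b

theorem IsStringPair.opPow_some {e f : B → Option B} (h : IsStringPair e f) {k : ℕ} {b c : B}
    (hb : opPow f k b = some c) :
    opPow e k c = some b ∧ (stringLength f b).toNat = (stringLength f c).toNat + k ∧
      (stringLength e c).toNat = (stringLength e b).toNat + k := by
  induction k generalizing b with
  | zero => simp only [opPow_zero, Option.some.injEq] at hb; subst hb; simp [opPow_zero]
  | succ k ih =>
    rw [opPow_succ] at hb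
    obtain ⟨d, hd, hdc⟩ := Option.bind_eq_some_iff.1 hb
    obtain ⟨h1, h2, h3⟩ := ih hdc
    have he := (h.inv d b).2 hd
    refine ⟨?_, ?_, ?_⟩
    · rw [opPow_succ', h1]; exact he
    · rw [h.toNat_of_some hd]; omega
    · have := h.swap.toNat_of_some he; omega

/-- The reversal of strings, as a partial operator. -/
noncomputable def stringReverse (e f : B → Option B) (b : B) : Option B :=
  if (stringLength e b).toNat ≤ (stringLength f b).toNat then
    opPow f ((stringLength f b).toNat - (stringLength e b).toNat) b
  else opPow e ((stringLength e b).toNat - (stringLength f b).toNat) b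

theorem IsStringPair.stringReverse_spec {e f : B → Option B} (h : IsStringPair e f) (b : B) :
    ∃ c, stringReverse e f b = some c ∧ stringReverse e f c = some b ∧
      (stringLength e c).toNat = (stringLength f b).toNat ∧
      (stringLength f c).toNat = (stringLength e b).toNat := by
  by_cases hle : (stringLength e b).toNat ≤ (stringLength f b).toNat
  · set k := (stringLength f b).toNat - (stringLength e b).toNat with hk
    obtain ⟨c, hc⟩ := Option.ne_none_iff_exists'.1 ((h.opPow_ne_none_iff k b).2 (by omega))
    obtain ⟨h1, h2, h3⟩ := h.opPow_some hc
    refine ⟨c, by rw [stringReverse, if_pos hle, ← hk, hc], ?_, by omega, by omega⟩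
    unfold stringReverse
    split_ifs with h4
    · have : k = 0 := by omega
      have h5 : (stringLength f c).toNat - (stringLength e c).toNat = 0 := by omega
      rw [this] at h1
      rw [h5]; exact h1
    · rw [show (stringLength e c).toNat - (stringLength f c).toNat = k by omega, h1]
  · set k := (stringLength e b).toNat - (stringLength f b).toNat with hk
    obtain ⟨c, hc⟩ := Option.ne_none_iff_exists'.1 ((h.swap.opPow_ne_none_iff k b).2 (by omega))
    obtain ⟨h1, h2, h3⟩ := h.swap.opPow_some hc
    refine ⟨c, by rw [stringReverse, if_neg hle, ← hk, hc], ?_, by omega, by omega⟩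
    rw [stringReverse, if_pos (by omega),
      show (stringLength f c).toNat - (stringLength e c).toNat = k by omega, h1]

/-- The reversal of strings, as a permutation. -/
noncomputable def IsStringPair.reverse {e f : B → Option B} (h : IsStringPair e f) :
    Equiv.Perm B :=
  Function.Involutive.toPerm (fun b => (h.stringReverse_spec b).choose) fun b => by
    have h1 := (h.stringReverse_spec b).choose_spec.2.1
    have h2 := (h.stringReverse_spec (h.stringReverse_spec b).choose).choose_spec.1
    exact Option.some.inj (h2.symm.trans h1)

theorem IsStringPair.some_reverse {e f : B → Option B} (h : IsStringPair e f) (b : B) :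
    some (h.reverse b) = stringReverse e f b :=
  ((h.stringReverse_spec b).choose_spec.1).symm

theorem IsStringPair.reverse_reverse {e f : B → Option B} (h : IsStringPair e f) (b : B) :
    h.reverse (h.reverse b) = b :=
  Function.Involutive.toPerm_involutive _ b

theorem IsStringPair.reverse_mul_self {e f : B → Option B} (h : IsStringPair e f) :
    h.reverse * h.reverse = 1 :=
  Equiv.ext h.reverse_reverse

theorem IsStringPair.toNat_e_reverse {e f : B → Option B} (h : IsStringPair e f) (b : B) :
    (stringLength e (h.reverse b)).toNat = (stringLength f b).toNat :=
  (h.stringReverse_spec b).choose_spec.2.2.1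

theorem IsStringPair.toNat_f_reverse {e f : B → Option B} (h : IsStringPair e f) (b : B) :
    (stringLength f (h.reverse b)).toNat = (stringLength e b).toNat :=
  (h.stringReverse_spec b).choose_spec.2.2.2

theorem optionRel_opPow {R : B → C → Prop} {g : B → Option B} {g' : C → Option C}
    (h : ∀ b c, R b c → Option.Rel R (g b) (g' c)) (k : ℕ) {b : B} {c : C} (hbc : R b c) :
    Option.Rel R (opPow g k b) (opPow g' k c) := by
  induction k generalizing b c with
  | zero => exact .some hbc
  | succ k ih =>
    rw [opPow_succ, opPow_succ]
    have := h b c hbc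
    revert this
    generalize g b = x
    generalize g' c = y
    rintro (h | _)
    · exact ih h
    · exact .none

theorem stringLength_eq_of_rel {R : B → C → Prop} {g : B → Option B} {g' : C → Option C}
    (h : ∀ b c, R b c → Option.Rel R (g b) (g' c)) {b : B} {c : C} (hbc : R b c) :
    stringLength g b = stringLength g' c := by
  have key : ∀ k, opPow g k b ≠ none ↔ opPow g' k c ≠ none := fun k => by
    have := optionRel_opPow h k hbc
    revert this
    generalize opPow g k b = x
    generalize opPow g' k c = y
    rintro (h | _) <;> simp
  simp only [stringLength, key]

/-- A relation compatible with two pairs of operators is compatible with string reversal. -/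
theorem IsStringPair.rel_reverse {R : B → C → Prop} {e f : B → Option B} {e' f' : C → Option C}
    (h : IsStringPair e f) (h' : IsStringPair e' f')
    (he : ∀ b c, R b c → Option.Rel R (e b) (e' c))
    (hf : ∀ b c, R b c → Option.Rel R (f b) (f' c)) {b : B} {c : C} (hbc : R b c) :
    R (h.reverse b) (h'.reverse c) := by
  have key : Option.Rel R (some (h.reverse b)) (some (h'.reverse c)) := by
    rw [h.some_reverse, h'.some_reverse, stringReverse, stringReverse,
      stringLength_eq_of_rel he hbc, stringLength_eq_of_rel hf hbc]
    split_ifs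
    · exact optionRel_opPow hf _ hbc
    · exact optionRel_opPow he _ hbc
  cases key with
  | some h => exact h

end Strings

end QPlus

namespace QPlus

open CrystalData

section Words

variable {n : ℕ}

/-- The word with first letter `x` and remaining letters `w`. -/
def wordCons {m : ℕ} (x : Fin n × Bool) (w : PowerCarrier n m) : PowerCarrier n (m + 1) := (x, w)

theorem exists_wordCons {m : ℕ} (w : PowerCarrier n (m + 1)) : ∃ x v, w = wordCons x v :=
  ⟨w.1, w.2, rfl⟩

theorem wordCons_inj {m : ℕ} {x y : Fin n × Bool} {v w : PowerCarrier n m}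
    (h : wordCons x v = wordCons y w) : x = y ∧ v = w :=
  Prod.mk.inj h

/-- `φ_i` of a letter. -/
def letterφ (i : ℕ) (x : Fin n × Bool) : ℕ := if x.1.val = i then 1 else 0

/-- `ε_i` of a letter. -/
def letterε (i : ℕ) (x : Fin n × Bool) : ℕ := if x.1.val = i + 1 then 1 else 0

/-- `φ_i` of a word. -/
def wordφ (i : ℕ) : (m : ℕ) → PowerCarrier n m → ℕ
  | 0, _ => 0
  | m + 1, (x, w) => letterφ i x + (wordφ i m w - letterε i x)

/-- `ε_i` of a word. -/
def wordε (i : ℕ) : (m : ℕ) → PowerCarrier n m → ℕ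
  | 0, _ => 0
  | m + 1, (x, w) => wordε i m w + (letterε i x - wordφ i m w)

/-- The number of occurrences of a letter in a word, primes being disregarded. -/
def wordCount (j : ℕ) : (m : ℕ) → PowerCarrier n m → ℕ
  | 0, _ => 0
  | m + 1, (x, w) => letterφ j x + wordCount j m w

theorem wordφ_cons (i : ℕ) {m : ℕ} (x : Fin n × Bool) (w : PowerCarrier n m) :
    wordφ i (m + 1) (wordCons x w) = letterφ i x + (wordφ i m w - letterε i x) := rfl

theorem wordε_cons (i : ℕ) {m : ℕ} (x : Fin n × Bool) (w : PowerCarrier n m) :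
    wordε i (m + 1) (wordCons x w) = wordε i m w + (letterε i x - wordφ i m w) := rfl

theorem wordCount_cons (j : ℕ) {m : ℕ} (x : Fin n × Bool) (w : PowerCarrier n m) :
    wordCount j (m + 1) (wordCons x w) = letterφ j x + wordCount j m w := rfl

theorem wordCount_sub (m i : ℕ) (w : PowerCarrier n m) :
    wordφ i m w + wordCount (i + 1) m w = wordε i m w + wordCount i m w := by
  induction m with
  | zero => rfl
  | succ m ih =>
    obtain ⟨x, w, rfl⟩ := exists_wordCons w
    have := ih w
    simp only [wordφ_cons, wordε_cons, wordCount_cons, letterφ, letterε]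
    split_ifs <;> omega

/-- One step of the carrier that computes `σ_i`: from its load and a letter to the new letter and
the new load. -/
def carrierStep (i : ℕ) (hi : i + 1 < n) (h : ℕ) (x : Fin n × Bool) : (Fin n × Bool) × ℕ :=
  if x.1.val = i + 1 then (x, h + 1)
  else if x.1.val = i then (if h = 0 then ((⟨i + 1, hi⟩, x.2), 0) else (x, h - 1))
  else (x, h)

/-- The carrier run through a word from the left. -/
def carrier (i : ℕ) (hi : i + 1 < n) : (m : ℕ) → ℕ → PowerCarrier n m → PowerCarrier n m × ℕ
  | 0, h, w => (w, h)
  | m + 1, h, (x, w) =>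
    let y := carrierStep i hi h x
    let v := carrier i hi m y.2 w
    ((y.1, v.1), v.2)

theorem carrier_cons_fst (i : ℕ) (hi : i + 1 < n) {m : ℕ} (h : ℕ) (x : Fin n × Bool)
    (w : PowerCarrier n m) : (carrier i hi (m + 1) h (wordCons x w)).1 =
      wordCons (carrierStep i hi h x).1 (carrier i hi m (carrierStep i hi h x).2 w).1 := rfl

theorem carrier_cons_snd (i : ℕ) (hi : i + 1 < n) {m : ℕ} (h : ℕ) (x : Fin n × Bool)
    (w : PowerCarrier n m) : (carrier i hi (m + 1) h (wordCons x w)).2 =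
      (carrier i hi m (carrierStep i hi h x).2 w).2 := rfl

theorem tmul_some_left {B C : Type*} (b : B) (y : Option C) :
    tmul (some b) y = y.map (Prod.mk b) := rfl

theorem tmul_some_right {B C : Type*} (x : Option B) (c : C) :
    tmul x (some c) = x.map fun b => (b, c) := by
  cases x <;> rfl

theorem standard_ε (i : ℕ) (hi : i + 1 < n) (x : Fin n × Bool) :
    (standard n).ε (.gl i hi) x = letterε i x := by
  refine stringLength_eq_of_rank (p := letterε i) (fun x hx => ?_) (fun x y hxy => ?_) x
  · simp only [standard, Fin.ext_iff] at hx
    split_ifs at hx with h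
    simp [letterε, h]
  · simp only [standard, Fin.ext_iff] at hxy
    split_ifs at hxy with h
    simp only [Option.some.injEq] at hxy
    subst hxy
    simp [letterε, h]

theorem standardPower_f_gl [NeZero n] {m : ℕ} (i : ℕ) (hi : i + 1 < n)
    (hφ : ∀ w, (standardPower n m).φ (.gl i hi) w = wordφ i m w)
    (x : Fin n × Bool) (w : PowerCarrier n m) :
    (standardPower n (m + 1)).f (.gl i hi) (wordCons x w) =
      if letterε i x < wordφ i m w then ((standardPower n m).f (.gl i hi) w).map (wordCons x)
      else if x.1.val = i then some (wordCons (⟨i + 1, hi⟩, x.2) w) else none := by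
  have h : (tensor (standard n) (standardPower n m)).f (.gl i hi) (x, w) =
      if letterε i x < wordφ i m w then ((standardPower n m).f (.gl i hi) w).map (Prod.mk x)
      else if x.1.val = i then some ((⟨i + 1, hi⟩, x.2), w) else none := by
    simp only [tensor, hφ, standard_ε, Nat.cast_lt, tmul_some_left, tmul_some_right]
    simp only [standard, Fin.ext_iff]
    split_ifs <;> rfl
  exact h

theorem standardPower_e_gl [NeZero n] {m : ℕ} (i : ℕ) (hi : i + 1 < n)
    (hφ : ∀ w, (standardPower n m).φ (.gl i hi) w = wordφ i m w)
    (x : Fin n × Bool) (w : PowerCarrier n m) :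
    (standardPower n (m + 1)).e (.gl i hi) (wordCons x w) =
      if letterε i x ≤ wordφ i m w then ((standardPower n m).e (.gl i hi) w).map (wordCons x)
      else if x.1.val = i + 1 then some (wordCons (⟨i, by omega⟩, x.2) w) else none := by
  have h : (tensor (standard n) (standardPower n m)).e (.gl i hi) (x, w) =
      if letterε i x ≤ wordφ i m w then ((standardPower n m).e (.gl i hi) w).map (Prod.mk x)
      else if x.1.val = i + 1 then some ((⟨i, by omega⟩, x.2), w) else none := by
    simp only [tensor, hφ, standard_ε, Nat.cast_le, tmul_some_left, tmul_some_right]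
    simp only [standard, Fin.ext_iff]
    split_ifs <;> rfl
  exact h

/-- The behaviour of `e_i` and `f_i` on words for `1 ≤ i`. -/
structure WordStrings [NeZero n] (m i : ℕ) (hi : i + 1 < n) : Prop where
  f_none : ∀ w, (standardPower n m).f (.gl i hi) w = none → wordφ i m w = 0
  f_some : ∀ w w', (standardPower n m).f (.gl i hi) w = some w' →
    wordφ i m w = wordφ i m w' + 1 ∧ wordε i m w' = wordε i m w + 1 ∧
      ∀ j, wordCount j m w + (if j = i + 1 then 1 else 0) =
        wordCount j m w' + (if j = i then 1 else 0)
  e_none : ∀ w, (standardPower n m).e (.gl i hi) w = none → wordε i m w = 0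
  inv : ∀ w w', (standardPower n m).e (.gl i hi) w = some w' ↔
    (standardPower n m).f (.gl i hi) w' = some w

variable [NeZero n]

theorem WordStrings.φ_eq {m i : ℕ} {hi : i + 1 < n} (h : WordStrings m i hi)
    (w : PowerCarrier n m) : (standardPower n m).φ (.gl i hi) w = wordφ i m w :=
  stringLength_eq_of_rank (p := wordφ i m) h.f_none (fun w w' hw => (h.f_some w w' hw).1) w

theorem WordStrings.ε_eq {m i : ℕ} {hi : i + 1 < n} (h : WordStrings m i hi)
    (w : PowerCarrier n m) : (standardPower n m).ε (.gl i hi) w = wordε i m w :=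
  stringLength_eq_of_rank (p := wordε i m) h.e_none
    (fun w w' hw => (h.f_some w' w ((h.inv w w').1 hw)).2.1) w

theorem wordStrings (m i : ℕ) (hi : i + 1 < n) : WordStrings (n := n) m i hi := by
  induction m with
  | zero =>
    refine ⟨fun _ _ => rfl, fun w w' h => ?_, fun _ _ => rfl, fun w w' => ?_⟩
    · simp [standardPower, unit] at h
    · simp [standardPower, unit]
  | succ m ih =>
    have hf := standardPower_f_gl i hi ih.φ_eq
    have he := standardPower_e_gl i hi ih.φ_eq
    refine ⟨?_, ?_, ?_, ?_⟩
    · intro w h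
      obtain ⟨x, w, rfl⟩ := exists_wordCons w
      rw [hf] at h
      split_ifs at h with h1 h2
      · rw [Option.map_eq_none_iff] at h
        have := ih.f_none w h
        omega
      · simp only [wordφ_cons, letterφ, h2]
        simp only [if_false]
        omega
    · intro w v h
      obtain ⟨x, w, rfl⟩ := exists_wordCons w
      obtain ⟨y, v, rfl⟩ := exists_wordCons v
      rw [hf] at h
      split_ifs at h with h1 h2
      · obtain ⟨w', hw', h⟩ := Option.map_eq_some_iff.1 h
        obtain ⟨rfl, rfl⟩ := wordCons_inj h
        obtain ⟨h3, h4, h5⟩ := ih.f_some _ _ hw'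
        simp only [wordφ_cons, wordε_cons, wordCount_cons]
        refine ⟨by omega, by omega, fun j => ?_⟩
        have := h5 j
        omega
      · obtain ⟨rfl, rfl⟩ := wordCons_inj (Option.some.inj h)
        simp only [wordφ_cons, wordε_cons, wordCount_cons, letterφ, letterε, h2] at *
        simp at *
        refine ⟨by omega, by omega, fun j => ?_⟩
        split_ifs <;> omega
    · intro w h
      obtain ⟨x, w, rfl⟩ := exists_wordCons w
      rw [he] at h
      split_ifs at h with h1 h2
      · rw [Option.map_eq_none_iff] at h
        have := ih.e_none w h
        simp only [wordε_cons]
        omega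
      · exact absurd (by simp [letterε, h2]) h1
    · intro w v
      obtain ⟨x, w, rfl⟩ := exists_wordCons w
      obtain ⟨y, v, rfl⟩ := exists_wordCons v
      rw [he, hf]
      constructor
      · intro h
        split_ifs at h with h1 h2
        · obtain ⟨w', hw', h⟩ := Option.map_eq_some_iff.1 h
          obtain ⟨rfl, rfl⟩ := wordCons_inj h
          have hw := (ih.inv _ _).1 hw'
          have := (ih.f_some _ _ hw).1
          rw [if_pos (by omega), hw]; rfl
        · obtain ⟨rfl, rfl⟩ := wordCons_inj (Option.some.inj h)
          have : wordφ i m w = 0 := by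
            simp only [letterε] at h1; split_ifs at h1; omega
          rw [if_neg (by omega), if_pos rfl]
          exact congrArg (fun x => some (wordCons x _)) (Prod.ext (Fin.ext h2.symm) rfl)
      · intro h
        split_ifs at h with h1 h2
        · obtain ⟨w', hw', h⟩ := Option.map_eq_some_iff.1 h
          obtain ⟨rfl, rfl⟩ := wordCons_inj h
          have hw := (ih.inv _ _).2 hw'
          have := (ih.f_some _ _ hw').1
          rw [if_pos (by omega), hw]; rfl
        · obtain ⟨rfl, rfl⟩ := wordCons_inj (Option.some.inj h)
          have : wordφ i m v = 0 := by
            simp only [letterε, h2] at h1; simp at h1; omega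
          rw [if_neg (by simp [letterε, this]), if_pos rfl]
          exact congrArg (fun x => some (wordCons x _)) (Prod.ext (Fin.ext h2.symm) rfl)

theorem standardPower_isStringPair (m i : ℕ) (hi : i + 1 < n) :
    IsStringPair ((standardPower n m).e (.gl i hi)) ((standardPower n m).f (.gl i hi)) where
  inv := (wordStrings m i hi).inv
  e_fin w := by
    have := (wordStrings m i hi).ε_eq w
    rw [CrystalData.ε] at this
    simp [this]
  f_fin w := by
    have := (wordStrings m i hi).φ_eq w
    rw [CrystalData.φ] at this
    simp [this]

/-- The reversal `σ_i` of `i`-strings on words. -/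
noncomputable def wordσ (m i : ℕ) (hi : i + 1 < n) : Equiv.Perm (PowerCarrier n m) :=
  (standardPower_isStringPair m i hi).reverse

theorem wordσ_wordσ (m i : ℕ) (hi : i + 1 < n) (w : PowerCarrier n m) :
    wordσ m i hi (wordσ m i hi w) = w :=
  (standardPower_isStringPair m i hi).reverse_reverse w

theorem toNat_stringLength_e (m i : ℕ) (hi : i + 1 < n) (w : PowerCarrier n m) :
    (stringLength ((standardPower n m).e (.gl i hi)) w).toNat = wordε i m w := by
  have := (wordStrings m i hi).ε_eq w
  rw [CrystalData.ε] at this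
  simp [this]

theorem toNat_stringLength_f (m i : ℕ) (hi : i + 1 < n) (w : PowerCarrier n m) :
    (stringLength ((standardPower n m).f (.gl i hi)) w).toNat = wordφ i m w := by
  have := (wordStrings m i hi).φ_eq w
  rw [CrystalData.φ] at this
  simp [this]

theorem wordφ_wordσ (m i : ℕ) (hi : i + 1 < n) (w : PowerCarrier n m) :
    wordφ i m (wordσ m i hi w) = wordε i m w := by
  have := (standardPower_isStringPair m i hi).toNat_f_reverse w
  rwa [toNat_stringLength_e, toNat_stringLength_f] at this

theorem wordε_wordσ (m i : ℕ) (hi : i + 1 < n) (w : PowerCarrier n m) :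
    wordε i m (wordσ m i hi w) = wordφ i m w := by
  have := (standardPower_isStringPair m i hi).toNat_e_reverse w
  rwa [toNat_stringLength_e, toNat_stringLength_f] at this

theorem some_wordσ_of_le {m i : ℕ} {hi : i + 1 < n} {w : PowerCarrier n m}
    (h : wordε i m w ≤ wordφ i m w) :
    some (wordσ m i hi w) =
      opPow ((standardPower n m).f (.gl i hi)) (wordφ i m w - wordε i m w) w := by
  rw [wordσ, IsStringPair.some_reverse, stringReverse, toNat_stringLength_e,
    toNat_stringLength_f, if_pos h]

/-- To prove a `σ_i`-stable property, it suffices to consider words with `ε_i ≤ φ_i`. -/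
theorem forall_of_wordε_le {m i : ℕ} (hi : i + 1 < n) {p : PowerCarrier n m → Prop}
    (hp : ∀ w, p (wordσ m i hi w) → p w) (h : ∀ w, wordε i m w ≤ wordφ i m w → p w)
    (w : PowerCarrier n m) : p w := by
  rcases le_total (wordε i m w) (wordφ i m w) with hle | hle
  · exact h w hle
  · exact hp w (h _ (by rwa [wordε_wordσ, wordφ_wordσ]))

theorem wordCount_opPow {m i : ℕ} {hi : i + 1 < n} {k : ℕ} {w w' : PowerCarrier n m}
    (h : opPow ((standardPower n m).f (.gl i hi)) k w = some w') (j : ℕ) :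
    wordCount j m w + (if j = i + 1 then k else 0) = wordCount j m w' + (if j = i then k else 0) := by
  induction k generalizing w with
  | zero =>
    obtain rfl := Option.some.inj h
    simp
  | succ k ih =>
    rw [opPow_succ] at h
    obtain ⟨v, hv, h⟩ := Option.bind_eq_some_iff.1 h
    have h1 := ih h
    have h2 := ((wordStrings m i hi).f_some w v hv).2.2 j
    split_ifs at * <;> omega

/-- `σ_i` exchanges the numbers of letters `i` and `i + 1`. -/
theorem wordCount_wordσ (m i : ℕ) (hi : i + 1 < n) (w : PowerCarrier n m) (j : ℕ) :
    wordCount j m (wordσ m i hi w) =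
      wordCount (if j = i then i + 1 else if j = i + 1 then i else j) m w := by
  revert j
  refine forall_of_wordε_le hi (p := fun w => ∀ j, wordCount j m (wordσ m i hi w) =
      wordCount (if j = i then i + 1 else if j = i + 1 then i else j) m w) ?_ ?_ w
  · intro w h j
    rw [wordσ_wordσ] at h
    rw [h]
    congr 1
    split_ifs <;> omega
  · intro w hle j
    have h1 := wordCount_opPow (some_wordσ_of_le (hi := hi) hle).symm j
    have h2 := wordCount_sub m i w
    split_ifs at * <;> simp_all <;> omega

theorem wordCount_wordσ_left (m i : ℕ) (hi : i + 1 < n) (w : PowerCarrier n m) :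
    wordCount i m (wordσ m i hi w) = wordCount (i + 1) m w := by
  rw [wordCount_wordσ, if_pos rfl]

theorem wordCount_wordσ_right (m i : ℕ) (hi : i + 1 < n) (w : PowerCarrier n m) :
    wordCount (i + 1) m (wordσ m i hi w) = wordCount i m w := by
  rw [wordCount_wordσ, if_neg (by omega), if_pos rfl]

theorem wordCount_wordσ_of_ne (m i : ℕ) (hi : i + 1 < n) (w : PowerCarrier n m) {j : ℕ}
    (h1 : j ≠ i) (h2 : j ≠ i + 1) : wordCount j m (wordσ m i hi w) = wordCount j m w := by
  rw [wordCount_wordσ, if_neg h1, if_neg h2]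

theorem opPow_f_cons {m i : ℕ} {hi : i + 1 < n} {k : ℕ} {x : Fin n × Bool}
    {w w' : PowerCarrier n m} (h : opPow ((standardPower n m).f (.gl i hi)) k w = some w')
    (hk : k = 0 ∨ k + letterε i x ≤ wordφ i m w) :
    opPow ((standardPower n (m + 1)).f (.gl i hi)) k (wordCons x w) =
      some (wordCons x w') := by
  induction k generalizing w with
  | zero =>
    obtain rfl := Option.some.inj h
    rfl
  | succ k ih =>
    rw [opPow_succ] at h ⊢
    obtain ⟨v, hv, h⟩ := Option.bind_eq_some_iff.1 h
    have h1 := ((wordStrings m i hi).f_some w v hv).1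
    rw [standardPower_f_gl i hi (wordStrings m i hi).φ_eq, if_pos (by omega), hv]
    exact ih h (by omega)

theorem carrier_spec (m i : ℕ) (hi : i + 1 < n) (h : ℕ) (w : PowerCarrier n m) :
    opPow ((standardPower n m).f (.gl i hi)) (wordφ i m w - h) w = some (carrier i hi m h w).1 ∧
      (carrier i hi m h w).2 = wordε i m w + (h - wordφ i m w) := by
  induction m generalizing h with
  | zero => simp [carrier, wordφ, wordε]; rfl
  | succ m ih =>
    obtain ⟨x, w, rfl⟩ := exists_wordCons w
    simp only [carrier_cons_fst, carrier_cons_snd, carrierStep, wordφ_cons, wordε_cons, letterφ]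
    split_ifs with h1 h2 h3 h4
    · omega
    · have hx : letterε i x = 0 := by simp [letterε, h2]
      obtain ⟨h6, h7⟩ := ih 0 w
      rw [hx, h3, show 1 + (wordφ i m w - 0) - 0 = wordφ i m w - 0 + 1 by omega, opPow_succ',
        opPow_f_cons h6 (by omega)]
      have h8 := ((standardPower_isStringPair m i hi).opPow_some h6).2.1
      rw [toNat_stringLength_f, toNat_stringLength_f] at h8
      refine ⟨?_, by simp only [h7]; omega⟩
      rw [Option.bind_some, standardPower_f_gl i hi (wordStrings m i hi).φ_eq,
        if_neg (by omega), if_pos h1]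
    · have hx : letterε i x = 0 := by simp [letterε, h2]
      obtain ⟨h6, h7⟩ := ih (h - 1) w
      rw [hx, show 1 + (wordφ i m w - 0) - h = wordφ i m w - (h - 1) by omega]
      exact ⟨opPow_f_cons h6 (by omega), by simp only [h7]; omega⟩
    · have hx : letterε i x = 1 := by simp [letterε, h4]
      obtain ⟨h6, h7⟩ := ih (h + 1) w
      rw [hx, show 0 + (wordφ i m w - 1) - h = wordφ i m w - (h + 1) by omega]
      exact ⟨opPow_f_cons h6 (by omega), by simp only [h7]; omega⟩
    · have hx : letterε i x = 0 := by simp [letterε, h4]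
      obtain ⟨h6, h7⟩ := ih h w
      rw [hx, show 0 + (wordφ i m w - 0) - h = wordφ i m w - h by omega]
      exact ⟨opPow_f_cons h6 (by omega), by simp only [h7]; omega⟩

/-- A carrier that returns to its initial load computes `σ_i`. -/
theorem carrier_eq_wordσ {m i : ℕ} {hi : i + 1 < n} {h : ℕ} {w : PowerCarrier n m}
    (hs : (carrier i hi m h w).2 = h) : (carrier i hi m h w).1 = wordσ m i hi w := by
  obtain ⟨h1, h2⟩ := carrier_spec m i hi h w
  rw [hs] at h2
  apply Option.some.inj
  rw [some_wordσ_of_le (by omega), ← h1]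
  congr 1
  omega

theorem carrier_wordε {m i : ℕ} {hi : i + 1 < n} {w : PowerCarrier n m}
    (h : wordε i m w ≤ wordφ i m w) : (carrier i hi m (wordε i m w) w).2 = wordε i m w := by
  rw [(carrier_spec m i hi _ w).2]; omega

end Words

end QPlus

namespace QPlus

open CrystalData

section Relations

variable {n : ℕ}

/-- The relation between the old and new values of the load and of the letter in a step of the
carrier. -/
def CarrierRel (i h v v' h' : ℕ) : Prop :=
  (v = i + 1 ∧ v' = i + 1 ∧ h' = h + 1) ∨ (v = i ∧ h = 0 ∧ v' = i + 1 ∧ h' = 0) ∨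
    (v = i ∧ h ≠ 0 ∧ v' = i ∧ h' + 1 = h) ∨ (v ≠ i ∧ v ≠ i + 1 ∧ v' = v ∧ h' = h)

theorem carrierRel_carrierStep (i : ℕ) (hi : i + 1 < n) (h : ℕ) (x : Fin n × Bool) :
    CarrierRel i h x.1.val (carrierStep i hi h x).1.1.val (carrierStep i hi h x).2 := by
  unfold CarrierRel carrierStep
  split_ifs <;> simp_all
  omega

theorem CarrierRel.comm {i j g h v v₁ v₂ u₁ u₂ g₁ g₂ h₁ h₂ : ℕ} (hij : i + 2 ≤ j)
    (r₁ : CarrierRel j g v v₁ g₁) (r₂ : CarrierRel i h v₁ v₂ h₂)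
    (s₁ : CarrierRel i h v u₁ h₁) (s₂ : CarrierRel j g u₁ u₂ g₂) :
    v₂ = u₂ ∧ h₂ = h₁ ∧ g₂ = g₁ := by
  unfold CarrierRel at *
  omega

theorem CarrierRel.braid {i a b c v v₁ v₂ v₃ a' b' c' d u₁ u₂ u₃ p q r : ℕ}
    (r₁ : CarrierRel i a v v₁ a') (r₂ : CarrierRel (i + 1) b v₁ v₂ b')
    (r₃ : CarrierRel i c v₂ v₃ c') (hd : d = min a c)
    (s₁ : CarrierRel (i + 1) (b + c - d) v u₁ p) (s₂ : CarrierRel i d u₁ u₂ q)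
    (s₃ : CarrierRel (i + 1) (a + b - d) u₂ u₃ r) :
    u₃ = v₃ ∧ p = b' + c' - min a' c' ∧ q = min a' c' ∧ r = a' + b' - min a' c' := by
  unfold CarrierRel at *
  rcases r₁ with r₁ | r₁ | r₁ | r₁ <;> rcases r₂ with r₂ | r₂ | r₂ | r₂ <;>
    try (exfalso; clear r₃ s₁ s₂ s₃; omega)
  all_goals rcases r₃ with r₃ | r₃ | r₃ | r₃ <;> try (exfalso; clear s₁ s₂ s₃; omega)
  all_goals rcases s₁ with s₁ | s₁ | s₁ | s₁ <;> try (exfalso; clear s₂ s₃; omega)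
  all_goals rcases s₂ with s₂ | s₂ | s₂ | s₂ <;> try (exfalso; clear s₃; omega)
  all_goals omega

theorem carrierStep_fst_snd (i : ℕ) (hi : i + 1 < n) (h : ℕ) (x : Fin n × Bool) :
    (carrierStep i hi h x).1.2 = x.2 := by
  unfold carrierStep
  split_ifs <;> rfl

theorem carrierStep_comm {i j : ℕ} (hi : i + 1 < n) (hj : j + 1 < n) (hij : i + 2 ≤ j)
    (g h : ℕ) (x : Fin n × Bool) :
    (carrierStep i hi h (carrierStep j hj g x).1).1 =
      (carrierStep j hj g (carrierStep i hi h x).1).1 ∧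
    (carrierStep i hi h (carrierStep j hj g x).1).2 = (carrierStep i hi h x).2 ∧
    (carrierStep j hj g (carrierStep i hi h x).1).2 = (carrierStep j hj g x).2 := by
  obtain ⟨h1, h2, h3⟩ := CarrierRel.comm hij (carrierRel_carrierStep j hj g x)
    (carrierRel_carrierStep i hi h _) (carrierRel_carrierStep i hi h x)
    (carrierRel_carrierStep j hj g _)
  exact ⟨Prod.ext (Fin.ext h1) (by simp only [carrierStep_fst_snd]), h2, h3⟩

theorem carrier_comm {i j : ℕ} (hi : i + 1 < n) (hj : j + 1 < n) (hij : i + 2 ≤ j) (m : ℕ)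
    (g h : ℕ) (w : PowerCarrier n m) :
    (carrier i hi m h (carrier j hj m g w).1).1 = (carrier j hj m g (carrier i hi m h w).1).1 ∧
    (carrier i hi m h (carrier j hj m g w).1).2 = (carrier i hi m h w).2 ∧
    (carrier j hj m g (carrier i hi m h w).1).2 = (carrier j hj m g w).2 := by
  induction m generalizing g h with
  | zero => exact ⟨rfl, rfl, rfl⟩
  | succ m ih =>
    obtain ⟨x, w, rfl⟩ := exists_wordCons w
    obtain ⟨h1, h2, h3⟩ := carrierStep_comm hi hj hij g h x
    simp only [carrier_cons_fst, carrier_cons_snd, h1, h2, h3]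
    obtain ⟨h4, h5, h6⟩ := ih (carrierStep j hj g x).2 (carrierStep i hi h x).2 w
    exact ⟨congrArg _ h4, h5, h6⟩

/-- Three consecutive carriers for `i`, `i + 1`, `i` with loads `a`, `b`, `c` are equivalent to
three consecutive carriers for `i + 1`, `i`, `i + 1` with loads `b + c - min a c`, `min a c`,
`a + b - min a c`. -/
theorem carrierStep_braid {i : ℕ} (hi : i + 2 < n) (a b c : ℕ) (x : Fin n × Bool) :
    let x₁ := carrierStep i (by omega) a x
    let x₂ := carrierStep (i + 1) hi b x₁.1
    let x₃ := carrierStep i (by omega) c x₂.1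
    let y₁ := carrierStep (i + 1) hi (b + c - min a c) x
    let y₂ := carrierStep i (by omega) (min a c) y₁.1
    let y₃ := carrierStep (i + 1) hi (a + b - min a c) y₂.1
    y₃.1 = x₃.1 ∧ y₁.2 = x₂.2 + x₃.2 - min x₁.2 x₃.2 ∧ y₂.2 = min x₁.2 x₃.2 ∧
      y₃.2 = x₁.2 + x₂.2 - min x₁.2 x₃.2 := by
  intro x₁ x₂ x₃ y₁ y₂ y₃
  have hsnd : y₃.1.2 = x₃.1.2 := by
    simp only [x₁, x₂, x₃, y₁, y₂, y₃, carrierStep_fst_snd]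
  obtain ⟨h1, h2⟩ := CarrierRel.braid (carrierRel_carrierStep i (by omega) a x)
    (carrierRel_carrierStep (i + 1) hi b x₁.1) (carrierRel_carrierStep i (by omega) c x₂.1) rfl
    (carrierRel_carrierStep (i + 1) hi (b + c - min a c) x)
    (carrierRel_carrierStep i (by omega) (min a c) y₁.1)
    (carrierRel_carrierStep (i + 1) hi (a + b - min a c) y₂.1)
  exact ⟨Prod.ext (Fin.ext h1) hsnd, h2⟩

theorem carrier_braid {i : ℕ} (hi : i + 2 < n) (m a b c : ℕ) (w : PowerCarrier n m) :
    let w₁ := carrier i (by omega) m a w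
    let w₂ := carrier (i + 1) hi m b w₁.1
    let w₃ := carrier i (by omega) m c w₂.1
    let v₁ := carrier (i + 1) hi m (b + c - min a c) w
    let v₂ := carrier i (by omega) m (min a c) v₁.1
    let v₃ := carrier (i + 1) hi m (a + b - min a c) v₂.1
    v₃.1 = w₃.1 ∧ v₁.2 = w₂.2 + w₃.2 - min w₁.2 w₃.2 ∧ v₂.2 = min w₁.2 w₃.2 ∧
      v₃.2 = w₁.2 + w₂.2 - min w₁.2 w₃.2 := by
  induction m generalizing a b c with
  | zero => exact ⟨rfl, rfl, rfl, rfl⟩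
  | succ m ih =>
    obtain ⟨x, w, rfl⟩ := exists_wordCons w
    obtain ⟨h1, h2, h3, h4⟩ := carrierStep_braid hi a b c x
    simp only [carrier_cons_fst, carrier_cons_snd, h1, h2, h3, h4]
    obtain ⟨h5, h6, h7, h8⟩ := ih _ _ _ w
    exact ⟨congrArg _ h5, h6, h7, h8⟩

variable [NeZero n]

theorem wordσ_comm {m i j : ℕ} (hi : i + 1 < n) (hj : j + 1 < n) (hij : i + 2 ≤ j)
    (w : PowerCarrier n m) :
    wordσ m i hi (wordσ m j hj w) = wordσ m j hj (wordσ m i hi w) := by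
  refine forall_of_wordε_le hi
    (p := fun w => wordσ m i hi (wordσ m j hj w) = wordσ m j hj (wordσ m i hi w))
    (fun w h => ?_) (fun w hwi => ?_) w
  · rw [wordσ_wordσ] at h
    rw [← h, wordσ_wordσ]
  · revert hwi
    refine forall_of_wordε_le hj (p := fun w => wordε i m w ≤ wordφ i m w →
      wordσ m i hi (wordσ m j hj w) = wordσ m j hj (wordσ m i hi w))
      (fun w h hwi => ?_) (fun w hwj hwi => ?_) w
    · have h1 := wordCount_sub m i w
      have h2 := wordCount_sub m i (wordσ m j hj w)
      rw [wordCount_wordσ, wordCount_wordσ, if_neg (by omega), if_neg (by omega),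
        if_neg (by omega), if_neg (by omega)] at h2
      have := h (by omega)
      rw [wordσ_wordσ] at this
      rw [this, wordσ_wordσ]
    · obtain ⟨h1, h2, h3⟩ := carrier_comm hi hj hij m (wordε j m w) (wordε i m w) w
      have h4 := carrier_wordε (hi := hi) hwi
      have h5 := carrier_wordε (hi := hj) hwj
      have h6 := carrier_eq_wordσ h4
      have h7 := carrier_eq_wordσ h5
      have h8 := carrier_eq_wordσ (h2.trans h4)
      have h9 := carrier_eq_wordσ (h3.trans h5)
      rw [← h7, ← h8, h1, h9, h6]

theorem wordσ_braid_of_dominant {m i : ℕ} (hi : i + 2 < n) {w : PowerCarrier n m}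
    (h1 : wordCount (i + 1) m w ≤ wordCount i m w)
    (h2 : wordCount (i + 2) m w ≤ wordCount (i + 1) m w) :
    wordσ m i (by omega) (wordσ m (i + 1) hi (wordσ m i (by omega) w)) =
      wordσ m (i + 1) hi (wordσ m i (by omega) (wordσ m (i + 1) hi w)) := by
  have hi' : i + 1 < n := by omega
  change wordCount (i + 1 + 1) m w ≤ _ at h2
  set w₁ := wordσ m i hi' w with hw₁
  set w₂ := wordσ m (i + 1) hi w₁ with hw₂
  have e1 := wordCount_sub m i w
  have e2 := wordCount_sub m (i + 1) w₁
  have e3 := wordCount_sub m i w₂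
  rw [hw₁, wordCount_wordσ_right, wordCount_wordσ_of_ne _ _ _ _ (by omega) (by omega),
    ← hw₁] at e2
  rw [hw₂, wordCount_wordσ_left, wordCount_wordσ_of_ne (j := i) _ _ _ _ (by omega) (by omega),
    hw₁, wordCount_wordσ_left, wordCount_wordσ_of_ne _ _ _ _ (by omega) (by omega), ← hw₁,
    ← hw₂] at e3
  have c1 := carrier_wordε (hi := hi') (w := w) (by omega)
  have c2 := carrier_wordε (hi := hi) (w := w₁) (by omega)
  have c3 := carrier_wordε (hi := hi') (w := w₂) (by omega)
  have s1 := carrier_eq_wordσ c1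
  have s2 := carrier_eq_wordσ c2
  have s3 := carrier_eq_wordσ c3
  obtain ⟨b1, b2, b3, b4⟩ := carrier_braid hi m (wordε i m w) (wordε (i + 1) m w₁)
    (wordε i m w₂) w
  rw [← hw₁] at s1
  rw [← hw₂] at s2
  simp only [s1, s2, s3, c1, c2, c3] at b1 b2 b3 b4
  have t1 := carrier_eq_wordσ b2
  rw [t1] at b1 b3 b4
  have t2 := carrier_eq_wordσ b3
  rw [t2] at b1 b4
  have t3 := carrier_eq_wordσ b4
  rw [← b1, t3]

theorem wordσ_braid {m i : ℕ} (hi : i + 2 < n) (w : PowerCarrier n m) :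
    wordσ m i (by omega) (wordσ m (i + 1) hi (wordσ m i (by omega) w)) =
      wordσ m (i + 1) hi (wordσ m i (by omega) (wordσ m (i + 1) hi w)) := by
  have hi' : i + 1 < n := by omega
  let p : PowerCarrier n m → Prop := fun w =>
    wordσ m i hi' (wordσ m (i + 1) hi (wordσ m i hi' w)) =
      wordσ m (i + 1) hi (wordσ m i hi' (wordσ m (i + 1) hi w))
  have hp1 : ∀ w, p (wordσ m i hi' w) → p w := fun w h => by
    simp only [p, wordσ_wordσ] at h ⊢
    rw [← wordσ_wordσ m (i + 1) hi (wordσ m i hi' (wordσ m (i + 1) hi (wordσ m i hi' w))), ← h]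
  have hp2 : ∀ w, p (wordσ m (i + 1) hi w) → p w := fun w h => by
    simp only [p, wordσ_wordσ] at h ⊢
    rw [← h, wordσ_wordσ]
  have dom : ∀ w, wordCount (i + 1) m w ≤ wordCount i m w →
      wordCount (i + 2) m w ≤ wordCount (i + 1) m w → p w :=
    fun w h1 h2 => wordσ_braid_of_dominant hi h1 h2
  have half : ∀ w, wordCount (i + 1) m w ≤ wordCount i m w → p w := fun w h => by
    by_cases h1 : wordCount (i + 2) m w ≤ wordCount (i + 1) m w
    · exact dom w h h1
    · by_cases h2 : wordCount (i + 2) m w ≤ wordCount i m w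
      · refine hp2 w (dom _ ?_ ?_)
        · rw [wordCount_wordσ_left, wordCount_wordσ_of_ne _ _ _ _ (by omega) (by omega)]
          exact h2
        · rw [wordCount_wordσ_left, wordCount_wordσ_right]
          exact (not_le.1 h1).le
      · refine hp2 w (hp1 _ (dom _ ?_ ?_))
        · rw [wordCount_wordσ_left, wordCount_wordσ_right, wordCount_wordσ_left,
            wordCount_wordσ_of_ne _ _ _ _ (by omega) (by omega)]
          exact (not_le.1 h2).le
        · rw [wordCount_wordσ_right, wordCount_wordσ_of_ne _ _ _ _ (by omega) (by omega),
            wordCount_wordσ_right, wordCount_wordσ_of_ne _ _ _ _ (by omega) (by omega)]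
          exact h
  by_cases h : wordCount (i + 1) m w ≤ wordCount i m w
  · exact half w h
  · refine hp1 w (half _ ?_)
    rw [wordCount_wordσ_left, wordCount_wordσ_right]
    exact (not_le.1 h).le

end Relations

end QPlus

namespace QPlus

section Presentation

variable {G : Type*} [Group G]

/-- The Coxeter relations of type `BC` for the first `n` members of a sequence. -/
structure BCRelations (n : ℕ) (r : ℕ → G) : Prop where
  sq : ∀ i, i < n → r i * r i = 1
  comm : ∀ i j, i + 2 ≤ j → j < n → r i * r j = r j * r i
  braid : ∀ i, i + 2 < n → r (i + 1) * r (i + 2) * r (i + 1) = r (i + 2) * r (i + 1) * r (i + 2)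
  four : 1 < n → r 0 * r 1 * r 0 * r 1 = r 1 * r 0 * r 1 * r 0

theorem BCRelations.mono {n m : ℕ} {r : ℕ → G} (h : BCRelations n r) (hm : m ≤ n) :
    BCRelations m r where
  sq i hi := h.sq i (by omega)
  comm i j hij hj := h.comm i j hij (by omega)
  braid i hi := h.braid i (by omega)
  four hn := h.four (by omega)

/-- `r k * r (k + 1) * ⋯ * r (k + d - 1)`. -/
def ascProd (r : ℕ → G) : ℕ → ℕ → G
  | _, 0 => 1
  | k, d + 1 => r k * ascProd r (k + 1) d

/-- `r (k - 1) * ⋯ * r 1 * r 0 * r 1 * ⋯ * r (n - 1)`. -/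
def foldProd (r : ℕ → G) (n : ℕ) : ℕ → G
  | 0 => ascProd r 1 (n - 1)
  | k + 1 => r k * foldProd r n k

theorem BCRelations.ascProd_comm_of_lt {n : ℕ} {r : ℕ → G} (h : BCRelations n r) {i k d : ℕ}
    (hik : i + 2 ≤ k) (hk : k + d ≤ n) : r i * ascProd r k d = ascProd r k d * r i := by
  induction d generalizing k with
  | zero => simp [ascProd]
  | succ d ih =>
    rw [ascProd, ← mul_assoc, h.comm i k hik (by omega), mul_assoc, ih (by omega) (by omega),
      mul_assoc]

theorem BCRelations.mul_ascProd_of_gt {n : ℕ} {r : ℕ → G} (h : BCRelations n r) {i k d : ℕ}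
    (hk : 1 ≤ k) (hik : k ≤ i) (hi : i + 1 < k + d) (hn : k + d ≤ n) :
    r (i + 1) * ascProd r k d = ascProd r k d * r i := by
  induction d generalizing k with
  | zero => omega
  | succ d ih =>
    rcases hik.eq_or_lt with rfl | hlt
    · obtain ⟨d, rfl⟩ : ∃ d', d = d' + 1 := ⟨d - 1, by omega⟩
      obtain ⟨k, rfl⟩ : ∃ k', k = k' + 1 := ⟨k - 1, by omega⟩
      have hb := h.braid k (by omega)
      have hc := h.ascProd_comm_of_lt (i := k + 1) (k := k + 1 + 1 + 1) (d := d)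
        (by omega) (by omega)
      calc r (k + 1 + 1) * (r (k + 1) * (r (k + 1 + 1) * ascProd r (k + 1 + 1 + 1) d))
          = (r (k + 2) * r (k + 1) * r (k + 2)) * ascProd r (k + 1 + 1 + 1) d := by
            simp only [mul_assoc]
        _ = r (k + 1) * r (k + 2) * (r (k + 1) * ascProd r (k + 1 + 1 + 1) d) := by
            rw [← hb]; simp only [mul_assoc]
        _ = _ := by rw [hc]; simp only [ascProd, mul_assoc]
    · rw [ascProd, ← mul_assoc, ← h.comm k (i + 1) (by omega) (by omega), mul_assoc,
        ih (by omega) (by omega) (by omega) (by omega), mul_assoc]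

theorem BCRelations.mul_foldProd {n : ℕ} {r : ℕ → G} (h : BCRelations n r) {i k : ℕ}
    (hk1 : 1 ≤ k) (hk : k ≤ n) (hi : i < n) (hik : i ≠ k) (hik' : i + 1 ≠ k) :
    ∃ j, j + 1 < n ∧ r i * foldProd r n k = foldProd r n k * r j := by
  rcases lt_or_gt_of_ne hik with hlt | hgt
  · refine ⟨i, by omega, ?_⟩
    clear hk1
    induction k with
    | zero => omega
    | succ k ih =>
      by_cases hki : i + 1 = k
      · subst hki
        rcases i with _ | i
        · obtain ⟨m, rfl⟩ : ∃ m, n = m + 2 := ⟨n - 2, by omega⟩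
          have hc := h.ascProd_comm_of_lt (i := 0) (k := 2) (d := m) (by omega) (by omega)
          have hf := h.four (by omega)
          change r 0 * (r 1 * (r 0 * (r 1 * ascProd r 2 m))) =
            (r 1 * (r 0 * (r 1 * ascProd r 2 m))) * r 0
          calc _ = (r 0 * r 1 * r 0 * r 1) * ascProd r 2 m := by simp only [mul_assoc]
            _ = r 1 * r 0 * r 1 * (r 0 * ascProd r 2 m) := by rw [hf]; simp only [mul_assoc]
            _ = _ := by rw [hc]; simp only [mul_assoc]
        · have hb := h.braid i (by omega)
          have key : ∀ k, k ≤ i + 1 →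
              r (i + 1 + 1) * foldProd r n k = foldProd r n k * r (i + 1) := by
            intro k hk'
            induction k with
            | zero => exact h.mul_ascProd_of_gt le_rfl (by omega) (by omega) (by omega)
            | succ k ihk =>
              rw [foldProd, ← mul_assoc, ← h.comm k (i + 1 + 1) (by omega) (by omega), mul_assoc,
                ihk (by omega), mul_assoc]
          change r (i + 1) * (r (i + 2) * (r (i + 1) * foldProd r n (i + 1))) =
            (r (i + 2) * (r (i + 1) * foldProd r n (i + 1))) * r (i + 1)
          have := key (i + 1) le_rfl
          calc _ = (r (i + 1) * r (i + 2) * r (i + 1)) * foldProd r n (i + 1) := by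
                simp only [mul_assoc]
            _ = r (i + 2) * r (i + 1) * (r (i + 1 + 1) * foldProd r n (i + 1)) := by
                rw [hb]; simp only [mul_assoc]
            _ = _ := by rw [this]; simp only [mul_assoc]
      · rw [foldProd, ← mul_assoc, h.comm i k (by omega) (by omega), mul_assoc,
          ih (by omega) (by omega) hki (by omega), mul_assoc]
  · obtain ⟨i, rfl⟩ : ∃ i', i = i' + 1 := ⟨i - 1, by omega⟩
    refine ⟨i, by omega, ?_⟩
    have hmain : ∀ k, k < i + 1 → r (i + 1) * foldProd r n k = foldProd r n k * r i := by
      intro k hk'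
      induction k with
      | zero =>
        exact h.mul_ascProd_of_gt le_rfl (by omega) (by omega) (by omega)
      | succ k ihk =>
        rw [foldProd, ← mul_assoc, ← h.comm k (i + 1) (by omega) (by omega), mul_assoc,
          ihk (by omega), mul_assoc]
    exact hmain k hgt

/-- The generator `t_i` of the hyperoctahedral group, as a permutation of `ℤ`. -/
def signedSwap : ℕ → Equiv.Perm ℤ
  | 0 => Equiv.swap (-1) 1
  | i + 1 => Equiv.swap ((i : ℤ) + 1) ((i : ℤ) + 2) *
      Equiv.swap (-((i : ℤ) + 1)) (-((i : ℤ) + 2))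

theorem signedSwap_zero_apply (z : ℤ) :
    signedSwap 0 z = if z = -1 then 1 else if z = 1 then -1 else z := by
  simp [signedSwap, Equiv.swap_apply_def]

theorem signedSwap_succ_apply (i : ℕ) (z : ℤ) :
    signedSwap (i + 1) z = if z = (i : ℤ) + 1 then (i : ℤ) + 2 else
      if z = (i : ℤ) + 2 then (i : ℤ) + 1 else
      if z = -((i : ℤ) + 1) then -((i : ℤ) + 2) else
      if z = -((i : ℤ) + 2) then -((i : ℤ) + 1) else z := by
  simp only [signedSwap, Equiv.Perm.mul_apply, Equiv.swap_apply_def]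
  split_ifs <;> omega

theorem signedSwap_one_apply (z : ℤ) :
    signedSwap 1 z = if z = 1 then 2 else if z = 2 then 1 else
      if z = -1 then -2 else if z = -2 then -1 else z := by
  simpa using signedSwap_succ_apply 0 z

theorem signedSwap_succ_cases (i : ℕ) (z : ℤ) :
    (z = i + 1 ∧ signedSwap (i + 1) z = i + 2) ∨ (z = i + 2 ∧ signedSwap (i + 1) z = i + 1) ∨
    (z = -i - 1 ∧ signedSwap (i + 1) z = -i - 2) ∨ (z = -i - 2 ∧ signedSwap (i + 1) z = -i - 1) ∨
    (z ≠ i + 1 ∧ z ≠ i + 2 ∧ z ≠ -i - 1 ∧ z ≠ -i - 2 ∧ signedSwap (i + 1) z = z) := by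
  rw [signedSwap_succ_apply]
  split_ifs <;> omega

theorem signedSwap_braid (i : ℕ) (z : ℤ) :
    signedSwap (i + 1) (signedSwap (i + 2) (signedSwap (i + 1) z)) =
      signedSwap (i + 2) (signedSwap (i + 1) (signedSwap (i + 2) z)) := by
  have h1 := signedSwap_succ_cases i z
  have h2 := signedSwap_succ_cases (i + 1) (signedSwap (i + 1) z)
  have h3 := signedSwap_succ_cases i (signedSwap (i + 2) (signedSwap (i + 1) z))
  have h4 := signedSwap_succ_cases (i + 1) z
  have h5 := signedSwap_succ_cases i (signedSwap (i + 2) z)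
  have h6 := signedSwap_succ_cases (i + 1) (signedSwap (i + 1) (signedSwap (i + 2) z))
  push_cast [add_assoc] at h2 h4 h6
  generalize signedSwap (i + 1) (signedSwap (i + 2) (signedSwap (i + 1) z)) = y3 at *
  generalize signedSwap (i + 2) (signedSwap (i + 1) z) = y2 at *
  generalize signedSwap (i + 2) (signedSwap (i + 1) (signedSwap (i + 2) z)) = x3 at *
  generalize signedSwap (i + 1) (signedSwap (i + 2) z) = x2 at *
  generalize signedSwap (i + 1) z = y1 at *
  generalize signedSwap (i + 2) z = x1 at *
  rcases h1 with h1 | h1 | h1 | h1 | h1 <;> rcases h4 with h4 | h4 | h4 | h4 | h4 <;>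
    omega

theorem signedSwap_comm (i j : ℕ) (hij : i + 1 ≤ j) (z : ℤ) :
    signedSwap i (signedSwap (j + 1) z) = signedSwap (j + 1) (signedSwap i z) := by
  have h1 := signedSwap_succ_cases j z
  have h2 := signedSwap_succ_cases j (signedSwap i z)
  rcases i with _ | i
  · simp only [signedSwap_zero_apply] at *
    split_ifs at * <;> omega
  · have h3 := signedSwap_succ_cases i z
    have h4 := signedSwap_succ_cases i (signedSwap (j + 1) z)
    omega

theorem signedSwap_bcRelations (n : ℕ) : BCRelations n signedSwap where
  sq i _ := by
    ext z
    rcases i with _ | i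
    · simp only [Equiv.Perm.mul_apply, Equiv.Perm.one_apply, signedSwap_zero_apply]
      grind
    · have h1 := signedSwap_succ_cases i z
      have h2 := signedSwap_succ_cases i (signedSwap (i + 1) z)
      simp only [Equiv.Perm.mul_apply, Equiv.Perm.one_apply]
      omega
  comm i j hij _ := by
    obtain ⟨j, rfl⟩ : ∃ j', j = j' + 1 := ⟨j - 1, by omega⟩
    exact Equiv.ext fun z => signedSwap_comm i j (by omega) z
  braid i _ := Equiv.ext fun z => signedSwap_braid i z
  four _ := by
    ext z
    simp only [Equiv.Perm.mul_apply, signedSwap_zero_apply, signedSwap_one_apply]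
    grind

theorem signedSwap_mem (n i : ℕ) (hi : i < n) : signedSwap i ∈ WBC n := by
  rcases i with _ | i
  · have : NeZero n := ⟨by omega⟩
    exact (tZero n).2
  · exact (tGL n i hi).2

theorem map_ascProd {G' : Type*} [Group G'] (φ : G →* G') (r : ℕ → G) (k d : ℕ) :
    φ (ascProd r k d) = ascProd (fun i => φ (r i)) k d := by
  induction d generalizing k with
  | zero => simp [ascProd]
  | succ d ih => simp [ascProd, ih]

theorem map_foldProd {G' : Type*} [Group G'] (φ : G →* G') (r : ℕ → G) (n k : ℕ) :
    φ (foldProd r n k) = foldProd (fun i => φ (r i)) n k := by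
  induction k with
  | zero => simp [foldProd, map_ascProd]
  | succ d ih => simp [foldProd, ih]

theorem ascProd_mem {S : Subgroup G} {r : ℕ → G} {k d : ℕ}
    (h : ∀ i, i < k + d → r i ∈ S) : ascProd r k d ∈ S := by
  induction d generalizing k with
  | zero => exact S.one_mem
  | succ d ih => exact S.mul_mem (h k (by omega)) (ih fun i hi => h i (by omega))

theorem foldProd_mem {S : Subgroup G} {r : ℕ → G} {n k : ℕ} (hk : k ≤ n) (hn : 1 ≤ n)
    (h : ∀ i, i < n → r i ∈ S) : foldProd r n k ∈ S := by
  induction k with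
  | zero => exact ascProd_mem fun i hi => h i (by omega)
  | succ k ih => exact S.mul_mem (h k (by omega)) (ih (by omega))

theorem ascProd_signedSwap_apply (k d : ℕ) (hk : 1 ≤ k) :
    ascProd signedSwap k d ((k + d : ℕ) : ℤ) = k := by
  induction d generalizing k with
  | zero => simp [ascProd]
  | succ d ih =>
    obtain ⟨k, rfl⟩ : ∃ k', k = k' + 1 := ⟨k - 1, by omega⟩
    have := ih (k + 1 + 1) (by omega)
    rw [ascProd, Equiv.Perm.mul_apply, show k + 1 + (d + 1) = k + 1 + 1 + d by omega, this,
      signedSwap_succ_apply]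
    push_cast
    split_ifs <;> omega

theorem foldProd_signedSwap_apply (n k : ℕ) (hn : 1 ≤ n) :
    foldProd signedSwap n (k + 1) (n : ℤ) = -((k : ℤ) + 1) := by
  induction k with
  | zero =>
    have := ascProd_signedSwap_apply 1 (n - 1) le_rfl
    rw [show 1 + (n - 1) = n by omega] at this
    rw [foldProd, Equiv.Perm.mul_apply, foldProd, this, signedSwap_zero_apply]
    simp
  | succ k ih =>
    rw [foldProd, Equiv.Perm.mul_apply, ih, signedSwap_succ_apply]
    push_cast
    split_ifs <;> omega

/-- The subgroup generated by the first `n` members of a sequence. -/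
def initialSubgroup (r : ℕ → G) (n : ℕ) : Subgroup G := Subgroup.closure (r '' Set.Iio n)

theorem mem_initialSubgroup (r : ℕ → G) {n i : ℕ} (hi : i < n) : r i ∈ initialSubgroup r n :=
  Subgroup.subset_closure ⟨i, hi, rfl⟩

/-- Coset representatives of `initialSubgroup r n` in `initialSubgroup r (n + 1)`. -/
theorem BCRelations.exists_coset {n : ℕ} {r : ℕ → G} (h : BCRelations (n + 1) r) {x : G}
    (hx : x ∈ initialSubgroup r (n + 1)) :
    (∃ k d, 1 ≤ k ∧ k + d = n + 1 ∧ ∃ y ∈ initialSubgroup r n, x = ascProd r k d * y) ∨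
      ∃ k, k < n + 1 ∧ ∃ y ∈ initialSubgroup r n, x = foldProd r (n + 1) (k + 1) * y := by
  have step : ∀ i, i < n + 1 → ∀ x,
      ((∃ k d, 1 ≤ k ∧ k + d = n + 1 ∧ ∃ y ∈ initialSubgroup r n, x = ascProd r k d * y) ∨
      ∃ k, k < n + 1 ∧ ∃ y ∈ initialSubgroup r n, x = foldProd r (n + 1) (k + 1) * y) →
      ((∃ k d, 1 ≤ k ∧ k + d = n + 1 ∧ ∃ y ∈ initialSubgroup r n, r i * x = ascProd r k d * y) ∨
      ∃ k, k < n + 1 ∧ ∃ y ∈ initialSubgroup r n, r i * x = foldProd r (n + 1) (k + 1) * y) := by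
    rintro i hi x (⟨k, d, hk, hkd, y, hy, rfl⟩ | ⟨k, hk, y, hy, rfl⟩)
    · rcases lt_trichotomy i k with hlt | rfl | hgt
      · by_cases hik : i + 1 = k
        · subst hik
          rcases i with _ | i
          · refine .inr ⟨0, by omega, y, hy, ?_⟩
            obtain rfl : d = n := by omega
            simp [foldProd, mul_assoc]
          · exact .inl ⟨i + 1, d + 1, by omega, by omega, y, hy, by simp [ascProd, mul_assoc]⟩
        · refine .inl ⟨k, d, hk, hkd, r i * y, mul_mem (mem_initialSubgroup r (by omega)) hy, ?_⟩
          rw [← mul_assoc, h.ascProd_comm_of_lt (by omega) hkd.le, mul_assoc]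
      · obtain ⟨d, rfl⟩ : ∃ d', d = d' + 1 := ⟨d - 1, by omega⟩
        refine .inl ⟨i + 1, d, by omega, by omega, y, hy, ?_⟩
        rw [ascProd, ← mul_assoc, ← mul_assoc, h.sq i hi, one_mul]
      · obtain ⟨i, rfl⟩ : ∃ i', i = i' + 1 := ⟨i - 1, by omega⟩
        refine .inl ⟨k, d, hk, hkd, r i * y, mul_mem (mem_initialSubgroup r (by omega)) hy, ?_⟩
        rw [← mul_assoc, h.mul_ascProd_of_gt hk (by omega) (by omega) hkd.le, mul_assoc]
    · by_cases hik : i = k + 1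
      · subst hik
        exact .inr ⟨k + 1, hi, y, hy, (mul_assoc _ _ _).symm⟩
      · by_cases hik' : i = k
        · subst hik'
          have : r i * (foldProd r (n + 1) (i + 1) * y) = foldProd r (n + 1) i * y := by
            rw [foldProd, ← mul_assoc, ← mul_assoc, h.sq i hi, one_mul]
          rw [this]
          rcases i with _ | i
          · exact .inl ⟨1, n, le_rfl, by omega, y, hy, rfl⟩
          · exact .inr ⟨i, by omega, y, hy, rfl⟩
        · obtain ⟨j, hj, hjk⟩ := h.mul_foldProd (i := i) (k := k + 1) (by omega) (by omega) hi hik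
            (by omega)
          refine .inr ⟨k, hk, r j * y, mul_mem (mem_initialSubgroup r (by omega)) hy, ?_⟩
          rw [← mul_assoc, hjk, mul_assoc]
  refine Subgroup.closure_induction_left
    (p := fun x _ => (∃ k d, 1 ≤ k ∧ k + d = n + 1 ∧
        ∃ y ∈ initialSubgroup r n, x = ascProd r k d * y) ∨
      ∃ k, k < n + 1 ∧ ∃ y ∈ initialSubgroup r n, x = foldProd r (n + 1) (k + 1) * y)
    ?_ ?_ ?_ hx
  · exact .inl ⟨n + 1, 0, by omega, rfl, 1, one_mem _, by simp [ascProd]⟩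
  · rintro _ ⟨i, hi, rfl⟩ y _ hy
    exact step i hi y hy
  · rintro _ ⟨i, hi, rfl⟩ y _ hy
    rw [inv_eq_of_mul_eq_one_left (h.sq i hi)]
    exact step i hi y hy

theorem initialSubgroup_signedSwap_le (n : ℕ) : initialSubgroup signedSwap n ≤ WBC n := by
  refine (Subgroup.closure_le _).2 ?_
  rintro _ ⟨i, hi, rfl⟩
  exact signedSwap_mem n i hi

theorem eq_one_of_mem_WBC_zero {w : Equiv.Perm ℤ} (hw : w ∈ WBC 0) : w = 1 := by
  ext z
  have h0 : w 0 = 0 := by have := hw.1 0; rw [neg_zero] at this; omega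
  rcases lt_trichotomy z 0 with h | rfl | h
  · have h1 := hw.1 (-z)
    rw [hw.2 (-z) (by simpa using h)] at h1
    simpa using h1
  · simpa using h0
  · simpa using hw.2 z (by simpa using h)

theorem mem_WBC_of_fixed {n : ℕ} {w : Equiv.Perm ℤ} (hw : w ∈ WBC (n + 1))
    (h : w ((n + 1 : ℕ) : ℤ) = ((n + 1 : ℕ) : ℤ)) : w ∈ WBC n := by
  refine ⟨hw.1, fun i hi => ?_⟩
  rcases (show ((n + 1 : ℕ) : ℤ) = i ∨ ((n + 1 : ℕ) : ℤ) < i by push_cast; omega) with rfl | h'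
  · exact h
  · exact hw.2 i h'

theorem initialSubgroup_signedSwap (n : ℕ) : initialSubgroup signedSwap n = WBC n := by
  refine le_antisymm (initialSubgroup_signedSwap_le n) fun w hw => ?_
  induction n generalizing w with
  | zero => rw [eq_one_of_mem_WBC_zero hw]; exact one_mem _
  | succ n ih =>
    have main : ∀ u ∈ initialSubgroup signedSwap (n + 1),
        u ((n + 1 : ℕ) : ℤ) = w ((n + 1 : ℕ) : ℤ) → w ∈ initialSubgroup signedSwap (n + 1) := by
      intro u hu hue
      have h1 : u⁻¹ * w ∈ WBC n := by
        refine mem_WBC_of_fixed (mul_mem (inv_mem (initialSubgroup_signedSwap_le _ hu)) hw) ?_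
        rw [Equiv.Perm.mul_apply, ← hue, ← Equiv.Perm.mul_apply, inv_mul_cancel, Equiv.Perm.one_apply]
      have h2 : initialSubgroup signedSwap n ≤ initialSubgroup signedSwap (n + 1) :=
        Subgroup.closure_mono (Set.image_mono (Set.Iio_subset_Iio (by omega)))
      have := mul_mem hu (h2 (ih _ h1))
      rwa [mul_inv_cancel_left] at this
    have h0 : w 0 = 0 := by have := hw.1 0; rw [neg_zero] at this; omega
    have hle : ∀ z : ℤ, ((n + 1 : ℕ) : ℤ) < z → w ((n + 1 : ℕ) : ℤ) ≠ z := fun z hz he => by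
      rw [← hw.2 z hz] at he
      have := w.injective he
      omega
    have hge : ∀ z : ℤ, ((n + 1 : ℕ) : ℤ) < z → w ((n + 1 : ℕ) : ℤ) ≠ -z := fun z hz he => by
      rw [← hw.2 z hz, ← hw.1] at he
      have := w.injective he
      omega
    have hne : w ((n + 1 : ℕ) : ℤ) ≠ 0 := fun he => by
      rw [← h0] at he
      have := w.injective he
      omega
    have hmem : ∀ i, i < n + 1 → signedSwap i ∈ initialSubgroup signedSwap (n + 1) :=
      fun i hi => mem_initialSubgroup _ hi
    generalize hz : w ((n + 1 : ℕ) : ℤ) = z at *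
    have h1 : z ≤ (n + 1 : ℕ) := by
      by_contra hlt
      exact hle z (by omega) rfl
    have h2 : -((n + 1 : ℕ) : ℤ) ≤ z := by
      by_contra hlt
      exact hge (-z) (by omega) (by simp)
    rcases lt_or_gt_of_ne hne with hneg | hpos
    · obtain ⟨k, hk⟩ : ∃ k : ℕ, z = -((k : ℤ) + 1) := ⟨(-z - 1).toNat, by omega⟩
      refine main (foldProd signedSwap (n + 1) (k + 1))
        (foldProd_mem (by omega) (by omega) hmem) ?_
      rw [foldProd_signedSwap_apply _ _ (by omega), hk]
    · obtain ⟨k, hk⟩ : ∃ k : ℕ, z = k := ⟨z.toNat, by omega⟩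
      refine main (ascProd signedSwap k (n + 1 - k))
        (ascProd_mem fun i hi => hmem i (by omega)) ?_
      have := ascProd_signedSwap_apply k (n + 1 - k) (by omega)
      rw [show k + (n + 1 - k) = n + 1 by omega] at this
      rw [this, hk]

theorem BCRelations.eq_one_of_snd_eq_one {n : ℕ} {s : ℕ → G} (h : BCRelations n s)
    {x : G × Equiv.Perm ℤ} (hx : x ∈ initialSubgroup (fun i => (s i, signedSwap i)) n)
    (hx2 : x.2 = 1) : x = 1 := by
  have hr : ∀ n, BCRelations n s → BCRelations n (fun i => (s i, signedSwap i)) := fun n h =>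
    { sq := fun i hi => Prod.ext (h.sq i hi) ((signedSwap_bcRelations n).sq i hi)
      comm := fun i j hij hj =>
        Prod.ext (h.comm i j hij hj) ((signedSwap_bcRelations n).comm i j hij hj)
      braid := fun i hi => Prod.ext (h.braid i hi) ((signedSwap_bcRelations n).braid i hi)
      four := fun hn => Prod.ext (h.four hn) ((signedSwap_bcRelations n).four hn) }
  have hsnd : ∀ n, ∀ y ∈ initialSubgroup (fun i => (s i, signedSwap i)) n, y.2 ∈ WBC n := by
    intro n y hy
    have : initialSubgroup (fun i => (s i, signedSwap i)) n ≤
        (WBC n).comap (MonoidHom.snd G (Equiv.Perm ℤ)) := by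
      refine (Subgroup.closure_le _).2 ?_
      rintro _ ⟨i, hi, rfl⟩
      exact signedSwap_mem n i hi
    exact this hy
  induction n generalizing x with
  | zero => simpa [initialSubgroup] using hx
  | succ n ih =>
    have hlast : ∀ y ∈ initialSubgroup (fun i => (s i, signedSwap i)) n,
        y.2 ((n + 1 : ℕ) : ℤ) = ((n + 1 : ℕ) : ℤ) := fun y hy => (hsnd n y hy).2 _ (by simp)
    rcases (hr _ h).exists_coset hx with ⟨k, d, hk, hkd, y, hy, rfl⟩ | ⟨k, hk, y, hy, rfl⟩
    · have h1 := congrArg (fun w : Equiv.Perm ℤ => w ((n + 1 : ℕ) : ℤ)) hx2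
      simp only [Prod.snd_mul, Equiv.Perm.mul_apply, hlast y hy, Equiv.Perm.one_apply] at h1
      have h2 := map_ascProd (MonoidHom.snd G (Equiv.Perm ℤ)) (fun i => (s i, signedSwap i)) k d
      simp only [MonoidHom.coe_snd] at h2
      rw [h2, ← hkd] at h1
      rw [show (fun i => signedSwap i) = signedSwap from rfl,
        ascProd_signedSwap_apply k d hk] at h1
      obtain rfl : d = 0 := by omega
      rw [show ascProd (fun i => (s i, signedSwap i)) k 0 = 1 from rfl, one_mul] at hx2 ⊢
      exact ih (h.mono (by omega)) hy hx2
    · have h1 := congrArg (fun w : Equiv.Perm ℤ => w ((n + 1 : ℕ) : ℤ)) hx2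
      simp only [Prod.snd_mul, Equiv.Perm.mul_apply, hlast y hy, Equiv.Perm.one_apply] at h1
      have h2 := map_foldProd (MonoidHom.snd G (Equiv.Perm ℤ)) (fun i => (s i, signedSwap i))
        (n + 1) (k + 1)
      simp only [MonoidHom.coe_snd] at h2
      rw [h2, show (fun i => signedSwap i) = signedSwap from rfl,
        foldProd_signedSwap_apply _ _ (by omega)] at h1
      omega

/-- The universal property of the Coxeter presentation of the hyperoctahedral group. -/
theorem BCRelations.exists_hom {n : ℕ} {s : ℕ → G} (h : BCRelations n s) :
    ∃ φ : WBC n →* G, ∀ i (hi : i < n), φ ⟨signedSwap i, signedSwap_mem n i hi⟩ = s i := by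
  set H := initialSubgroup (fun i => (s i, signedSwap i)) n with hH
  have hmap : H.map (MonoidHom.snd G (Equiv.Perm ℤ)) = WBC n := by
    rw [hH, initialSubgroup, MonoidHom.map_closure, ← initialSubgroup_signedSwap,
      initialSubgroup, Set.image_image]
    rfl
  have hex : ∀ w : WBC n, ∃ g, (g, (w : Equiv.Perm ℤ)) ∈ H := fun w => by
    have : (w : Equiv.Perm ℤ) ∈ H.map (MonoidHom.snd G (Equiv.Perm ℤ)) := hmap.ge w.2
    obtain ⟨⟨g, v⟩, hg, hv⟩ := this
    obtain rfl : v = w := hv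
    exact ⟨g, hg⟩
  have huniq : ∀ g g' w, (g, w) ∈ H → (g', w) ∈ H → g = g' := fun g g' w hg hg' => by
    have := h.eq_one_of_snd_eq_one (mul_mem hg (inv_mem hg')) (by simp)
    exact mul_inv_eq_one.1 (congrArg Prod.fst this)
  choose g hg using hex
  refine ⟨MonoidHom.mk' g fun v w => ?_, fun i hi => ?_⟩
  · exact huniq _ _ _ (hg (v * w)) (mul_mem (hg v) (hg w))
  · exact huniq _ _ _ (hg _) (mem_initialSubgroup _ hi)

theorem WBC_hom_ext {n : ℕ} {φ ψ : WBC n →* G}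
    (h : ∀ i (hi : i < n), φ ⟨signedSwap i, signedSwap_mem n i hi⟩ =
      ψ ⟨signedSwap i, signedSwap_mem n i hi⟩) : φ = ψ := by
  have hle : WBC n ≤ (φ.eqLocus ψ).map (WBC n).subtype := by
    refine (initialSubgroup_signedSwap n).ge.trans ((Subgroup.closure_le _).2 ?_)
    rintro _ ⟨i, hi, rfl⟩
    exact ⟨⟨_, signedSwap_mem n i hi⟩, h i hi, rfl⟩
  ext w
  obtain ⟨v, hv, hvw⟩ := hle w.2
  obtain rfl : v = w := Subtype.ext hvw
  exact hv

end Presentation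

end QPlus

namespace QPlus

open CrystalData

section Primes

variable {n : ℕ}

/-- Adds or removes the prime of the letter in the given position, counted from `0`. -/
def togglePrime : (m : ℕ) → ℕ → PowerCarrier n m → PowerCarrier n m
  | 0, _, w => w
  | _ + 1, 0, (x, w) => ((x.1, !x.2), w)
  | m + 1, p + 1, (x, w) => (x, togglePrime m p w)

/-- The position of the first letter of lowest value, or the length of the word if there is no
such letter. -/
def firstOne : (m : ℕ) → PowerCarrier n m → ℕ
  | 0, _ => 0
  | m + 1, (x, w) => if x.1.val = 0 then 0 else firstOne m w + 1

/-- Whether the first letter of lowest value is primed. -/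
def firstPrime : (m : ℕ) → PowerCarrier n m → Option Bool
  | 0, _ => none
  | m + 1, (x, w) => if x.1.val = 0 then some x.2 else firstPrime m w

theorem togglePrime_cons_zero {m : ℕ} (x : Fin n × Bool) (w : PowerCarrier n m) :
    togglePrime (m + 1) 0 (wordCons x w) = wordCons (x.1, !x.2) w := rfl

theorem togglePrime_cons_succ {m : ℕ} (p : ℕ) (x : Fin n × Bool) (w : PowerCarrier n m) :
    togglePrime (m + 1) (p + 1) (wordCons x w) = wordCons x (togglePrime m p w) := rfl

theorem firstOne_cons {m : ℕ} (x : Fin n × Bool) (w : PowerCarrier n m) :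
    firstOne (m + 1) (wordCons x w) = if x.1.val = 0 then 0 else firstOne m w + 1 := rfl

theorem firstPrime_cons {m : ℕ} (x : Fin n × Bool) (w : PowerCarrier n m) :
    firstPrime (m + 1) (wordCons x w) = if x.1.val = 0 then some x.2 else firstPrime m w := rfl

theorem togglePrime_togglePrime (m p : ℕ) (w : PowerCarrier n m) :
    togglePrime m p (togglePrime m p w) = w := by
  induction m generalizing p with
  | zero => rfl
  | succ m ih =>
    obtain ⟨x, w, rfl⟩ := exists_wordCons w
    rcases p with _ | p
    · simp only [togglePrime_cons_zero, Bool.not_not]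
    · simp only [togglePrime_cons_succ, ih]

theorem togglePrime_comm (m p q : ℕ) (w : PowerCarrier n m) :
    togglePrime m p (togglePrime m q w) = togglePrime m q (togglePrime m p w) := by
  induction m generalizing p q with
  | zero => rfl
  | succ m ih =>
    obtain ⟨x, w, rfl⟩ := exists_wordCons w
    rcases p with _ | p <;> rcases q with _ | q <;>
      simp only [togglePrime_cons_zero, togglePrime_cons_succ, ih]

theorem firstOne_togglePrime (m p : ℕ) (w : PowerCarrier n m) :
    firstOne m (togglePrime m p w) = firstOne m w := by
  induction m generalizing p with
  | zero => rfl
  | succ m ih =>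
    obtain ⟨x, w, rfl⟩ := exists_wordCons w
    rcases p with _ | p <;>
      simp only [togglePrime_cons_zero, togglePrime_cons_succ, firstOne_cons, ih]

theorem firstPrime_togglePrime (m : ℕ) (w : PowerCarrier n m) :
    firstPrime m (togglePrime m (firstOne m w) w) = (firstPrime m w).map not := by
  induction m with
  | zero => rfl
  | succ m ih =>
    obtain ⟨x, w, rfl⟩ := exists_wordCons w
    by_cases h : x.1.val = 0 <;>
      simp [firstOne_cons, firstPrime_cons, togglePrime_cons_zero, togglePrime_cons_succ, h, ih]

theorem togglePrime_of_firstPrime_eq_none (m : ℕ) (w : PowerCarrier n m)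
    (hw : firstPrime m w = none) : togglePrime m (firstOne m w) w = w := by
  induction m with
  | zero => rfl
  | succ m ih =>
    obtain ⟨x, w, rfl⟩ := exists_wordCons w
    rw [firstPrime_cons] at hw
    split_ifs at hw with h
    rw [firstOne_cons, if_neg h, togglePrime_cons_succ, ih w hw]

theorem carrierStep_toggle (i : ℕ) (hi : i + 1 < n) (h : ℕ) (x : Fin n × Bool) :
    carrierStep i hi h (x.1, !x.2) =
      (((carrierStep i hi h x).1.1, !(carrierStep i hi h x).1.2), (carrierStep i hi h x).2) := by
  simp only [carrierStep]
  split_ifs <;> rfl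

theorem carrier_togglePrime (i : ℕ) (hi : i + 1 < n) (m h p : ℕ) (w : PowerCarrier n m) :
    (carrier i hi m h (togglePrime m p w)).1 = togglePrime m p (carrier i hi m h w).1 ∧
      (carrier i hi m h (togglePrime m p w)).2 = (carrier i hi m h w).2 := by
  induction m generalizing h p with
  | zero => exact ⟨rfl, rfl⟩
  | succ m ih =>
    obtain ⟨x, w, rfl⟩ := exists_wordCons w
    rcases p with _ | p
    · simp only [togglePrime_cons_zero, carrier_cons_fst, carrier_cons_snd, carrierStep_toggle,
        and_self]
    · obtain ⟨h1, h2⟩ := ih (carrierStep i hi h x).2 p w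
      simp only [togglePrime_cons_succ, carrier_cons_fst, carrier_cons_snd, h1, h2, and_self]

theorem firstOne_carrier {i : ℕ} (hi : i + 1 < n) (h1 : 1 ≤ i) (m h : ℕ)
    (w : PowerCarrier n m) : firstOne m (carrier i hi m h w).1 = firstOne m w := by
  induction m generalizing h with
  | zero => rfl
  | succ m ih =>
    obtain ⟨x, w, rfl⟩ := exists_wordCons w
    have := carrierRel_carrierStep i hi h x
    unfold CarrierRel at this
    rw [carrier_cons_fst, firstOne_cons, firstOne_cons, ih]
    split_ifs <;> omega

variable [NeZero n]

theorem wordσ_togglePrime {m i : ℕ} (hi : i + 1 < n) (p : ℕ) (w : PowerCarrier n m) :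
    wordσ m i hi (togglePrime m p w) = togglePrime m p (wordσ m i hi w) := by
  refine forall_of_wordε_le hi
    (p := fun w => wordσ m i hi (togglePrime m p w) = togglePrime m p (wordσ m i hi w))
    (fun w h => ?_) (fun w hw => ?_) w
  · rw [wordσ_wordσ] at h
    rw [← h, wordσ_wordσ]
  · have h1 := carrier_wordε (hi := hi) hw
    obtain ⟨h2, h3⟩ := carrier_togglePrime i hi m (wordε i m w) p w
    rw [← carrier_eq_wordσ h1, ← carrier_eq_wordσ (h3.trans h1), h2]

theorem firstOne_wordσ {m i : ℕ} (hi : i + 1 < n) (h1 : 1 ≤ i) (w : PowerCarrier n m) :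
    firstOne m (wordσ m i hi w) = firstOne m w := by
  refine forall_of_wordε_le hi
    (p := fun w => firstOne m (wordσ m i hi w) = firstOne m w) (fun w h => ?_) (fun w hw => ?_) w
  · rw [wordσ_wordσ] at h
    exact h.symm
  · rw [← carrier_eq_wordσ (carrier_wordε (hi := hi) hw), firstOne_carrier hi h1]

theorem standard_wt_zero_ne_zero (x : Fin n × Bool) : (standard n).wt x 0 ≠ 0 ↔ x.1.val = 0 := by
  simp only [standard, Pi.single_apply]
  constructor
  · intro h
    by_contra hx
    exact h (if_neg fun h0 => hx (by rw [← h0]; rfl))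
  · intro h
    rw [if_pos (Fin.ext (by rw [h]; rfl))]
    exact one_ne_zero

theorem standardPower_f_zero (m : ℕ) (w : PowerCarrier n m) :
    (standardPower n m).f .zero w =
      if firstPrime m w = some false then some (togglePrime m (firstOne m w) w) else none := by
  induction m with
  | zero => rfl
  | succ m ih =>
    obtain ⟨x, w, rfl⟩ := exists_wordCons w
    have h : (standardPower n (m + 1)).f .zero (wordCons x w) =
        if x.1.val = 0 then ((standard n).f .zero x).map (fun y => wordCons y w)
        else ((standardPower n m).f .zero w).map (wordCons x) := by
      have h : (tensor (standard n) (standardPower n m)).f .zero (x, w) =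
          if x.1.val = 0 then ((standard n).f .zero x).map (fun y => (y, w))
          else ((standardPower n m).f .zero w).map (Prod.mk x) := by
        simp only [tensor, standard_wt_zero_ne_zero, tmul_some_left, tmul_some_right]
      exact h
    rw [h, ih, firstPrime_cons, firstOne_cons]
    by_cases hx : x.1.val = 0
    · obtain ⟨v, _ | _⟩ := x <;> simp_all [standard, togglePrime_cons_zero]
    · simp only [hx, if_false, togglePrime_cons_succ]
      split_ifs <;> rfl

theorem standardPower_e_zero (m : ℕ) (w : PowerCarrier n m) :
    (standardPower n m).e .zero w =
      if firstPrime m w = some true then some (togglePrime m (firstOne m w) w) else none := by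
  induction m with
  | zero => rfl
  | succ m ih =>
    obtain ⟨x, w, rfl⟩ := exists_wordCons w
    have h : (standardPower n (m + 1)).e .zero (wordCons x w) =
        if x.1.val = 0 then ((standard n).e .zero x).map (fun y => wordCons y w)
        else ((standardPower n m).e .zero w).map (wordCons x) := by
      have h : (tensor (standard n) (standardPower n m)).e .zero (x, w) =
          if x.1.val = 0 then ((standard n).e .zero x).map (fun y => (y, w))
          else ((standardPower n m).e .zero w).map (Prod.mk x) := by
        simp only [tensor, standard_wt_zero_ne_zero, tmul_some_left, tmul_some_right]
      exact h
    rw [h, ih, firstPrime_cons, firstOne_cons]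
    by_cases hx : x.1.val = 0
    · obtain ⟨v, _ | _⟩ := x <;> simp_all [standard, togglePrime_cons_zero]
    · simp only [hx, if_false, togglePrime_cons_succ]
      split_ifs <;> rfl

theorem stringLength_f_zero (m : ℕ) (w : PowerCarrier n m) :
    stringLength ((standardPower n m).f .zero) w =
      ((if firstPrime m w = some false then 1 else 0 : ℕ) : ℕ∞) := by
  refine stringLength_eq_of_rank (p := fun w => if firstPrime m w = some false then 1 else 0)
    (fun w hw => ?_) (fun w w' hw => ?_) w
  · rw [standardPower_f_zero] at hw
    split_ifs at hw with h
    exact if_neg h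
  · rw [standardPower_f_zero] at hw
    split_ifs at hw with h
    obtain rfl := Option.some.inj hw
    simp [firstPrime_togglePrime, h]

theorem stringLength_e_zero (m : ℕ) (w : PowerCarrier n m) :
    stringLength ((standardPower n m).e .zero) w =
      ((if firstPrime m w = some true then 1 else 0 : ℕ) : ℕ∞) := by
  refine stringLength_eq_of_rank (p := fun w => if firstPrime m w = some true then 1 else 0)
    (fun w hw => ?_) (fun w w' hw => ?_) w
  · rw [standardPower_e_zero] at hw
    split_ifs at hw with h
    exact if_neg h
  · rw [standardPower_e_zero] at hw
    split_ifs at hw with h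
    obtain rfl := Option.some.inj hw
    simp [firstPrime_togglePrime, h]

theorem standardPower_isStringPair_zero (m : ℕ) :
    IsStringPair ((standardPower n m).e .zero) ((standardPower n m).f .zero) where
  inv w w' := by
    rw [standardPower_e_zero, standardPower_f_zero]
    constructor
    · intro h
      split_ifs at h with h1
      obtain rfl := Option.some.inj h
      rw [firstPrime_togglePrime, h1, firstOne_togglePrime, togglePrime_togglePrime]
      rfl
    · intro h
      split_ifs at h with h1
      obtain rfl := Option.some.inj h
      rw [firstPrime_togglePrime, h1, firstOne_togglePrime, togglePrime_togglePrime]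
      rfl
  e_fin w := by rw [stringLength_e_zero]; exact ENat.natCast_ne_top _
  f_fin w := by rw [stringLength_f_zero]; exact ENat.natCast_ne_top _

/-- `σ_0` adds or removes the prime of the first letter of lowest value. -/
theorem reverse_zero_apply (m : ℕ) (w : PowerCarrier n m) :
    (standardPower_isStringPair_zero m).reverse w = togglePrime m (firstOne m w) w := by
  apply Option.some.inj
  rw [IsStringPair.some_reverse, stringReverse, stringLength_e_zero, stringLength_f_zero]
  rcases h : firstPrime m w with _ | _ | _
  · simp [opPow_zero, togglePrime_of_firstPrime_eq_none m w h]
  · simp [opPow_succ, opPow_zero, standardPower_f_zero, h]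
  · simp [opPow_succ, opPow_zero, standardPower_e_zero, h]

/-- The operators `σ_0, …, σ_{n-1}` on words. -/
noncomputable def wordReflection (m : ℕ) : ℕ → Equiv.Perm (PowerCarrier n m)
  | 0 => (standardPower_isStringPair_zero m).reverse
  | i + 1 => if hi : i + 1 < n then wordσ m i hi else 1

theorem wordReflection_zero_apply (m : ℕ) (w : PowerCarrier n m) :
    wordReflection m 0 w = togglePrime m (firstOne m w) w :=
  reverse_zero_apply m w

theorem wordReflection_succ {m i : ℕ} (hi : i + 1 < n) :
    wordReflection (n := n) m (i + 1) = wordσ m i hi :=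
  dif_pos hi

theorem wordReflection_comm {m i j : ℕ} (hij : i + 2 ≤ j) (hj : j < n) (w : PowerCarrier n m) :
    wordReflection m i (wordReflection m j w) = wordReflection m j (wordReflection m i w) := by
  obtain ⟨j, rfl⟩ : ∃ j', j = j' + 1 := ⟨j - 1, by omega⟩
  rcases i with _ | i
  · rw [wordReflection_succ hj, wordReflection_zero_apply, wordReflection_zero_apply,
      firstOne_wordσ hj (by omega), wordσ_togglePrime]
  · have hi : i + 1 < n := by omega
    rw [wordReflection_succ hj, wordReflection_succ hi, wordσ_comm hi hj (by omega)]

theorem wordReflection_braid {m i : ℕ} (hi : i + 2 < n) (w : PowerCarrier n m) :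
    wordReflection m (i + 1) (wordReflection m (i + 2) (wordReflection m (i + 1) w)) =
      wordReflection m (i + 2) (wordReflection m (i + 1) (wordReflection m (i + 2) w)) := by
  rw [wordReflection_succ (by omega), wordReflection_succ (i := i + 1) hi, wordσ_braid hi]

theorem wordReflection_four {m : ℕ} (hn : 1 < n) (w : PowerCarrier n m) :
    wordReflection m 0 (wordReflection m 1 (wordReflection m 0 (wordReflection m 1 w))) =
      wordReflection m 1 (wordReflection m 0 (wordReflection m 1 (wordReflection m 0 w))) := by
  have h : wordReflection (n := n) m 1 = wordσ m 0 hn := wordReflection_succ hn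
  simp only [h, wordReflection_zero_apply, wordσ_togglePrime, firstOne_togglePrime, wordσ_wordσ]
  exact togglePrime_comm _ _ _ _

end Primes

end QPlus

namespace QPlus

open CrystalData

section Isomorphisms

variable {n : ℕ} {B : Type*} {X : CrystalData n B}

/-- Corresponding elements of isomorphic full subcrystals. -/
def IsoRel {C : Type*} {S : Set B} {T : Set C} (ψ : S ≃ T) (b : B) (c : C) : Prop :=
  ∃ hb : b ∈ S, (ψ ⟨b, hb⟩ : C) = c

theorem IsoRel.left_unique {C : Type*} {S : Set B} {T : Set C} {ψ : S ≃ T} {b b' : B} {c : C}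
    (h : IsoRel ψ b c) (h' : IsoRel ψ b' c) : b = b' := by
  obtain ⟨hb, h⟩ := h
  obtain ⟨hb', h'⟩ := h'
  exact congrArg Subtype.val (ψ.injective (Subtype.ext (h.trans h'.symm)))

theorem CrystalData.IsFullSubcrystal.mem_iff_of_edge {S : Set B} (hS : X.IsFullSubcrystal S)
    {i : Label n} {b c : B} (h : X.f i b = some c) : b ∈ S ↔ c ∈ S := by
  obtain ⟨a, rfl⟩ := hS
  have hbc : Relation.EqvGen X.Edge b c := .rel _ _ ⟨i, h⟩
  exact ⟨fun hb => .trans _ _ _ hb hbc, fun hc => .trans _ _ _ hc (.symm _ _ hbc)⟩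

variable {C : Type*} {Y : CrystalData n C} {S : Set B} {T : Set C} {ψ : S ≃ T}

theorem optionRel_f (hS : X.IsFullSubcrystal S) (hT : Y.IsFullSubcrystal T) {i : Label n}
    (hψ : ∀ x y : S, X.f i x = some (y : B) ↔ Y.f i (ψ x) = some (ψ y : C))
    (b : B) (c : C) (h : IsoRel ψ b c) : Option.Rel (IsoRel ψ) (X.f i b) (Y.f i c) := by
  obtain ⟨hb, rfl⟩ := h
  cases h : X.f i b with
  | some b' =>
    have hb' := (hS.mem_iff_of_edge h).1 hb
    rw [(hψ ⟨b, hb⟩ ⟨b', hb'⟩).1 h]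
    exact .some ⟨hb', rfl⟩
  | none =>
    cases h' : Y.f i (ψ ⟨b, hb⟩) with
    | none => exact .none
    | some c' =>
      have hc' := (hT.mem_iff_of_edge h').1 (ψ ⟨b, hb⟩).2
      have := (hψ ⟨b, hb⟩ (ψ.symm ⟨c', hc'⟩)).2 (by rw [h', Equiv.apply_symm_apply])
      rw [h] at this
      cases this

theorem optionRel_e (hS : X.IsFullSubcrystal S) (hT : Y.IsFullSubcrystal T) {i : Label n}
    (hX : ∀ b c, X.e i b = some c ↔ X.f i c = some b)
    (hY : ∀ b c, Y.e i b = some c ↔ Y.f i c = some b)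
    (hψ : ∀ x y : S, X.f i x = some (y : B) ↔ Y.f i (ψ x) = some (ψ y : C))
    (b : B) (c : C) (h : IsoRel ψ b c) : Option.Rel (IsoRel ψ) (X.e i b) (Y.e i c) := by
  obtain ⟨hb, rfl⟩ := h
  cases h : X.e i b with
  | some b' =>
    have h1 := (hX _ _).1 h
    have hb' := (hS.mem_iff_of_edge h1).2 hb
    rw [(hY _ _).2 ((hψ ⟨b', hb'⟩ ⟨b, hb⟩).1 h1)]
    exact .some ⟨hb', rfl⟩
  | none =>
    cases h' : Y.e i (ψ ⟨b, hb⟩) with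
    | none => exact .none
    | some c' =>
      have h1 := (hY _ _).1 h'
      have hc' := (hT.mem_iff_of_edge h1).2 (ψ ⟨b, hb⟩).2
      have := (hX _ _).2 ((hψ (ψ.symm ⟨c', hc'⟩) ⟨b, hb⟩).2 (by rw [Equiv.apply_symm_apply, h1]))
      rw [h] at this
      cases this

end Isomorphisms

section Transfer

variable {n : ℕ} [NeZero n] {B : Type*} {X : CrystalData n B}

theorem CrystalData.IsQPlusCrystal.isStringPair (hX : X.IsQPlusCrystal) (i : ℕ)
    (hi : i + 1 < n) : IsStringPair (X.e (.gl i hi)) (X.f (.gl i hi)) :=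
  ⟨hX.e_eq_iff i hi, hX.ε_finite i hi, hX.φ_finite i hi⟩

theorem CrystalData.IsQPlusCrystal.isStringPair_zero (hX : X.IsQPlusCrystal) :
    IsStringPair (X.e .zero) (X.f .zero) := by
  have h : ∀ b, X.ε .zero b + X.φ .zero b ≠ ⊤ := fun b => by
    by_cases hb : X.wt b 0 = 0
    · rw [hX.zero_string_zero b hb]; exact ENat.zero_ne_top
    · rw [hX.zero_string_one b hb]; exact ENat.one_ne_top
  exact ⟨hX.zero_e_eq_iff, fun b => ne_top_of_le_ne_top (h b) le_self_add,
    fun b => ne_top_of_le_ne_top (h b) le_add_self⟩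

/-- The operators `σ_0, …, σ_{n-1}` of a `q⁺_n`-crystal. -/
noncomputable def CrystalData.IsQPlusCrystal.reflection (hX : X.IsQPlusCrystal) :
    ℕ → Equiv.Perm B
  | 0 => hX.isStringPair_zero.reverse
  | i + 1 => if hi : i + 1 < n then (hX.isStringPair i hi).reverse else 1

theorem CrystalData.IsQPlusCrystal.some_reflection_zero (hX : X.IsQPlusCrystal) (b : B) :
    some (hX.reflection 0 b) = X.σ .zero b :=
  hX.isStringPair_zero.some_reverse b

theorem CrystalData.IsQPlusCrystal.some_reflection_succ (hX : X.IsQPlusCrystal) {i : ℕ}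
    (hi : i + 1 < n) (b : B) : some (hX.reflection (i + 1) b) = X.σ (.gl i hi) b := by
  rw [CrystalData.IsQPlusCrystal.reflection, dif_pos hi]
  exact (hX.isStringPair i hi).some_reverse b

/-- Each element of a normal crystal corresponds to a word, compatibly with the operators `σ_i`. -/
theorem CrystalData.IsQPlusCrystal.exists_word (hX : X.IsQPlusCrystal) (hnormal : X.IsNormal)
    (b : B) : ∃ (m : ℕ) (R : B → PowerCarrier n m → Prop) (w : PowerCarrier n m), R b w ∧
      (∀ b b' w, R b w → R b' w → b = b') ∧
      ∀ i b w, R b w → R (hX.reflection i b) (wordReflection m i w) := by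
  have hS : X.IsFullSubcrystal {c | Relation.EqvGen X.Edge b c} := ⟨b, rfl⟩
  obtain ⟨m, T, hT, ψ, -, hψ⟩ := hnormal _ hS
  refine ⟨m, IsoRel ψ, ψ ⟨b, .refl b⟩, ⟨.refl b, rfl⟩, fun _ _ _ h h' => h.left_unique h', ?_⟩
  rintro (_ | i) b w h
  · exact hX.isStringPair_zero.rel_reverse (standardPower_isStringPair_zero m)
      (optionRel_e hS hT hX.isStringPair_zero.inv (standardPower_isStringPair_zero m).inv
        (hψ .zero)) (optionRel_f hS hT (hψ .zero)) h
  · by_cases hi : i + 1 < n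
    · rw [wordReflection_succ hi, CrystalData.IsQPlusCrystal.reflection, dif_pos hi]
      exact (hX.isStringPair i hi).rel_reverse (standardPower_isStringPair m i hi)
        (optionRel_e hS hT (hX.isStringPair i hi).inv (standardPower_isStringPair m i hi).inv
          (hψ _)) (optionRel_f hS hT (hψ _)) h
    · rw [wordReflection, CrystalData.IsQPlusCrystal.reflection, dif_neg hi, dif_neg hi]
      exact h

theorem CrystalData.IsQPlusCrystal.bcRelations (hX : X.IsQPlusCrystal) (hnormal : X.IsNormal) :
    BCRelations n hX.reflection where
  sq i hi := by
    rcases i with _ | i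
    · exact hX.isStringPair_zero.reverse_mul_self
    · rw [CrystalData.IsQPlusCrystal.reflection, dif_pos hi]
      exact (hX.isStringPair i hi).reverse_mul_self
  comm i j hij hj := Equiv.ext fun b => by
    obtain ⟨m, R, w, hbw, hR, hσ⟩ := hX.exists_word hnormal b
    refine hR _ _ _ (hσ i _ _ (hσ j _ _ hbw)) ?_
    rw [wordReflection_comm hij hj]
    exact hσ j _ _ (hσ i _ _ hbw)
  braid i hi := Equiv.ext fun b => by
    obtain ⟨m, R, w, hbw, hR, hσ⟩ := hX.exists_word hnormal b
    refine hR _ _ _ (hσ (i + 1) _ _ (hσ (i + 2) _ _ (hσ (i + 1) _ _ hbw))) ?_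
    rw [wordReflection_braid hi]
    exact hσ (i + 2) _ _ (hσ (i + 1) _ _ (hσ (i + 2) _ _ hbw))
  four hn := Equiv.ext fun b => by
    obtain ⟨m, R, w, hbw, hR, hσ⟩ := hX.exists_word hnormal b
    refine hR _ _ _ (hσ 0 _ _ (hσ 1 _ _ (hσ 0 _ _ (hσ 1 _ _ hbw)))) ?_
    rw [wordReflection_four hn]
    exact hσ 1 _ _ (hσ 0 _ _ (hσ 1 _ _ (hσ 0 _ _ hbw)))

end Transfer

end QPlus

theorem mainTheorem6 {n : ℕ} [NeZero n] {B : Type*} (X : QPlus.CrystalData n B)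
    (hX : X.IsQPlusCrystal) (hnormal : X.IsNormal) :
    ∃! _ : MulAction (QPlus.WBC n) B,
      (∀ b : B, some (QPlus.tZero n • b) = X.σ .zero b) ∧
      ∀ (i : ℕ) (hi : i + 1 < n) (b : B),
        some (QPlus.tGL n i hi • b) = X.σ (.gl i hi) b := by
  have hn : 0 < n := Nat.pos_of_ne_zero (NeZero.ne n)
  obtain ⟨Φ, hΦ⟩ := (hX.bcRelations hnormal).exists_hom
  have h0 : Φ (QPlus.tZero n) = hX.reflection 0 := hΦ 0 hn
  have h1 : ∀ i (hi : i + 1 < n), Φ (QPlus.tGL n i hi) = hX.reflection (i + 1) :=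
    fun i hi => hΦ (i + 1) hi
  refine ⟨MulAction.compHom B Φ, ⟨fun b => ?_, fun i hi b => ?_⟩, fun A hA => ?_⟩
  · rw [← hX.some_reflection_zero, ← h0]
    rfl
  · rw [← hX.some_reflection_succ hi, ← h1]
    rfl
  · have key : @MulAction.toPermHom (QPlus.WBC n) B _ A = Φ := by
      refine QPlus.WBC_hom_ext fun i hi => Equiv.ext fun b => Option.some.inj ?_
      rw [hΦ i hi]
      rcases i with _ | i
      · rw [hX.some_reflection_zero]
        exact hA.1 b
      · rw [hX.some_reflection_succ hi]
        exact hA.2 i hi b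
    refine MulAction.ext (funext fun w => funext fun b => ?_)
    exact congrArg (fun F : QPlus.WBC n →* Equiv.Perm B => F w b) key
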